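/- **Theorem (generalized Pick's formula, Ehrhart polynomial, reciprocity).** Let $\mathcal P=(v_1,\dots,v_d)$, $d\ge 1$, be a sequence of points of $\mathbb Z^2$ (indices modulo $d$), regarded as an oriented closed piecewise linear loop with sides $v_iv_{i+1}$ (closed segments), together with signs $\epsilon_i\in\{+1,-1\}$, one for each side $v_iv_{i+1}$. Assume that $\mathcal P$ is a *lattice multi-polygon*, that is, for every $i$: 1. if $v_i$ lies on the segment $v_{i-1}v_{i+1}$, then $\epsilon_{i-1}=\epsilon_i$; 2. if $v_{i-1}$ lies on $v_iv_{i+1}$ or $v_{i+1}$ lies on $v_{i-1}v_i$, then $\epsilon_{i-1}\ne\epsilon_i$. (In particular $v_i\neq v_{i+1}$ for all $i$.) Let $n_i$ be the normal vector of the side $v_iv_{i+1}$ such that the counterclockwise rotation of $\epsilon_i n_i$ by $90$ degrees equals $v_{i+1}-v_i$. Let $d_{\mathcal P}(x)$ be the winding number of the loop $\mathcal P$ around a point $x\in\mathbb R^2$ that lies on no side, and put $$A(\mathcal P)=\int_{\mathbb R^2\setminus\mathcal P}d_{\mathcal P}(x)\,dx,\qquad B(\mathcal P)=\sum_{i=1}^d\epsilon_i\,\bigl(|v_iv_{i+1}\cap\mathbb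 Z^2|-1\bigr),$$ and let $C(\mathcal P)$ be the rotation number around the origin of the cyclic sequence $n_1,\dots,n_d$ (the sum of the signed angles, of absolute value less than $\pi$, from $n_i$ to $n_{i+1}$, divided by $2\pi$). For $t=(t_1,\dots,t_d)$ with all $t_i>0$, let $\mathcal P_+$ be the loop obtained by translating each side $v_iv_{i+1}$ by $t_in_i$ and joining the end $v_{i+1}+t_in_i$ of each translated side to the start $v_{i+1}+t_{i+1}n_{i+1}$ of the next by a segment. Then $d_{\mathcal P}$ is integrable on $\mathbb R^2\setminus\mathcal P$. For all sufficiently small $t$, the loop $\mathcal P_+$ misses $\mathbb Z^2$, only finitely many $u\in\mathbb Z^2$ have $d_{\mathcal P_+}(u)\ne0$, and the number $\sharp\mathcal P:=\sum_{u\in\mathbb Z^2}d_{\mathcal P_+}(u)$ does not depend on $t$ and satisfies $$\sharp\mathcal P=A(\mathcal P)+\tfrac12B(\mathcal P)+C(\mathcal P).$$ If $\mathcal P^\circ$ denotes $\mathcal P$ with all signs reversed, then $$\sharp\mathcal P^\circ=A(\mathcal P)-\tfrac12B(\mathcal P)+C(\mathcal P).$$ Moreover, for a positive integer $m$ let $m\mathcal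 P=(mv_1,\dots,mv_d)$ with the same signs, and let $E(x)=A(\mathcal P)x^2+\tfrac12B(\mathcal P)x+C(\mathcal P)$, a polynomial of degree at most $2$. Then, for every positive integer $m$, $$\sharp(m\mathcal P)=E(m)\qquad\text{and}\qquad \sharp(m\mathcal P^\circ)=E(-m).$$ -/

import Mathlib

open Filter Topology MeasureTheory

/-- A lattice point regarded as a point of the plane `ℝ² = ℂ`. -/
def latticePt (p : ℤ × ℤ) : ℂ := ⟨(p.1 : ℝ), (p.2 : ℝ)⟩

/-- The signed angle in `(-π, π]` from `a` to `b` as seen from `u`. For `u` off the closed segment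
`[a, b]` it is the total variation of angle around `u` along the directed segment from `a` to `b`
(see `sweptAngle_eq_lift`). -/
noncomputable def sweptAngle (u a b : ℂ) : ℝ := Complex.arg ((b - u) / (a - u))

/-- `sweptAngle u a b` is the increment of every continuous choice of angle of `x - u`, as `x`
runs along the segment from `a` to `b`; here for one such choice (two of them differ by a
constant). -/
theorem sweptAngle_eq_lift (u a b : ℂ) (hu : u ∉ segment ℝ a b) :
    ∃ θ : ℝ → ℝ, ContinuousOn θ (Set.Icc 0 1) ∧
      (∀ s ∈ Set.Icc (0 : ℝ) 1,
        a + s * (b - a) - u = ‖a + s * (b - a) - u‖ * Complex.exp (θ s * Complex.I)) ∧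
      θ 1 - θ 0 = sweptAngle u a b := by
  have hseg : ∀ s ∈ Set.Icc (0 : ℝ) 1, a + s * (b - a) ∈ segment ℝ a b := fun s hs => by
    rw [segment_eq_image']
    exact ⟨s, hs, by simp⟩
  have ha : a - u ≠ 0 := fun h => hu (by
    have := left_mem_segment ℝ a b
    rwa [sub_eq_zero.mp h] at this ⊢)
  have hne : ∀ s ∈ Set.Icc (0 : ℝ) 1, a + s * (b - a) - u ≠ 0 := fun s hs h =>
    hu (by rw [← sub_eq_zero.mp h]; exact hseg s hs)
  set q : ℝ → ℂ := fun s => (a + s * (b - a) - u) / (a - u) with hq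
  have hslit : ∀ s ∈ Set.Icc (0 : ℝ) 1, q s ∈ Complex.slitPlane := by
    intro s hs
    rw [Complex.mem_slitPlane_iff_not_le_zero]
    intro hle
    obtain ⟨h1, h2⟩ := Complex.le_def.mp hle
    have hre : q s = (((q s).re : ℝ) : ℂ) := Complex.ext (by simp) (by simpa using h2)
    set r := (q s).re
    have hr : r ≤ 0 := by simpa using h1
    have hx : a + s * (b - a) - u = r * (a - u) := by
      have : q s * (a - u) = a + s * (b - a) - u := div_mul_cancel₀ _ ha
      rw [← this, hre]
    apply hu
    rw [segment_eq_image']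
    have h1r : (0 : ℝ) < 1 - r := by linarith
    have h1c : ((1 : ℂ) - r) ≠ 0 := by exact_mod_cast h1r.ne'
    refine ⟨s / (1 - r), ⟨div_nonneg hs.1 h1r.le, ?_⟩, ?_⟩
    · rw [div_le_one h1r]; linarith [hs.2]
    · have : u * (1 - r) = a * (1 - r) + s * (b - a) := by linear_combination -hx
      simp only [Complex.real_smul]
      push_cast
      field_simp
      linear_combination -this
  refine ⟨fun s => Complex.arg (a - u) + Complex.arg (q s), ?_, ?_, ?_⟩
  · refine continuousOn_const.add fun s hs => ?_
    exact (Complex.continuousAt_arg (hslit s hs)).comp_continuousWithinAt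
      (by simp only [hq]; fun_prop)
  · intro s hs
    have e : a + s * (b - a) - u = (a - u) * q s := (mul_div_cancel₀ _ ha).symm
    have h1 := Complex.norm_mul_exp_arg_mul_I (a - u)
    have h2 := Complex.norm_mul_exp_arg_mul_I (q s)
    rw [e, norm_mul]
    push_cast
    rw [add_mul, Complex.exp_add]
    conv_lhs => rw [← h1, ← h2]
    ring
  · simp [hq, sweptAngle, div_self ha]

/-- A lattice multi-polygon: a cyclic sequence of `d ≥ 1` points of `ℤ²` (indices modulo `d`) with
a sign `sgn i` on the side from `vert i` to `vert (i + 1)`, subject to the two conditions on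
consecutive collinear triples. Segments are closed. -/
structure LatticeMultiPolygon (d : ℕ) [NeZero d] where
  /-- the vertices -/
  vert : Fin d → ℤ × ℤ
  /-- the sign of the side from `vert i` to `vert (i + 1)` -/
  sgn : Fin d → ℤˣ
  /-- the middle point lies between the other two: equal signs -/
  sgn_eq : ∀ i, latticePt (vert (i + 1)) ∈
      segment ℝ (latticePt (vert i)) (latticePt (vert (i + 1 + 1))) → sgn i = sgn (i + 1)
  /-- the first or the last point lies on the side opposite to it: different signs -/
  sgn_ne : ∀ i,
      (latticePt (vert i) ∈
          segment ℝ (latticePt (vert (i + 1))) (latticePt (vert (i + 1 + 1))) ∨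
        latticePt (vert (i + 1 + 1)) ∈
          segment ℝ (latticePt (vert i)) (latticePt (vert (i + 1)))) → sgn i ≠ sgn (i + 1)

namespace LatticeMultiPolygon

variable {d : ℕ} [NeZero d]

/-- The vertices as points of the plane. -/
def pt (P : LatticeMultiPolygon d) (i : Fin d) : ℂ := latticePt (P.vert i)

/-- The conditions on the signs rule out sides of length zero. -/
theorem pt_ne (P : LatticeMultiPolygon d) (i : Fin d) : P.pt i ≠ P.pt (i + 1) := by
  intro h
  unfold pt at h
  refine P.sgn_ne i (Or.inl ?_) (P.sgn_eq i ?_)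
  · rw [h]; exact left_mem_segment ℝ _ _
  · rw [← h]; exact left_mem_segment ℝ _ _

/-- The set of points of the plane that lie on a side. -/
def support (P : LatticeMultiPolygon d) : Set ℂ := ⋃ i, segment ℝ (P.pt i) (P.pt (i + 1))

/-- The winding number of the oriented loop `P` around a point `x` off its sides. -/
noncomputable def winding (P : LatticeMultiPolygon d) (x : ℂ) : ℝ :=
  (∑ i, sweptAngle x (P.pt i) (P.pt (i + 1))) / (2 * Real.pi)

/-- The normal vector of the `i`-th side: the counterclockwise rotation by 90 degrees, that is
multiplication by `Complex.I`, takes `sgn i • normal i` to the vector of the side. -/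
noncomputable def normal (P : LatticeMultiPolygon d) (i : Fin d) : ℂ :=
  ((P.sgn i : ℤ) : ℂ) * (-Complex.I * (P.pt (i + 1) - P.pt i))

/-- `A(P)`: the integral of the winding number over the complement of the sides. -/
noncomputable def area (P : LatticeMultiPolygon d) : ℝ := ∫ x in P.supportᶜ, P.winding x

/-- The number of lattice points on the `i`-th side, minus one. -/
noncomputable def sideLength (P : LatticeMultiPolygon d) (i : Fin d) : ℤ :=
  ({u : ℤ × ℤ | latticePt u ∈ segment ℝ (P.pt i) (P.pt (i + 1))}.ncard : ℤ) - 1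

/-- `B(P)`: the signed count of lattice lengths of the sides. -/
noncomputable def boundary (P : LatticeMultiPolygon d) : ℤ :=
  ∑ i, (P.sgn i : ℤ) * P.sideLength i

/-- `C(P)`: the rotation number around the origin of the cyclic sequence of the normal vectors.
Consecutive normal vectors are never opposite, so each turn has angle less than `π`. -/
noncomputable def rotation (P : LatticeMultiPolygon d) : ℝ :=
  (∑ i, sweptAngle 0 (P.normal i) (P.normal (i + 1))) / (2 * Real.pi)

/-- Starting point of the `i`-th side after it is pushed by `t i` times its normal vector. -/
noncomputable def pushStart (P : LatticeMultiPolygon d) (t : Fin d → ℝ) (i : Fin d) : ℂ :=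
  P.pt i + t i * P.normal i

/-- End point of the `i`-th side after it is pushed by `t i` times its normal vector. -/
noncomputable def pushEnd (P : LatticeMultiPolygon d) (t : Fin d → ℝ) (i : Fin d) : ℂ :=
  P.pt (i + 1) + t i * P.normal i

/-- The points of the pushed loop: the pushed sides, and for each vertex the short segment that
joins the end of one pushed side to the start of the next. -/
def pushSupport (P : LatticeMultiPolygon d) (t : Fin d → ℝ) : Set ℂ :=
  ⋃ i, (segment ℝ (P.pushStart t i) (P.pushEnd t i) ∪
    segment ℝ (P.pushEnd t i) (P.pushStart t (i + 1)))

/-- The winding number of the pushed loop around a point `x` off that loop. -/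
noncomputable def pushWinding (P : LatticeMultiPolygon d) (t : Fin d → ℝ) (x : ℂ) : ℝ :=
  (∑ i, (sweptAngle x (P.pushStart t i) (P.pushEnd t i) +
    sweptAngle x (P.pushEnd t i) (P.pushStart t (i + 1)))) / (2 * Real.pi)

/-- `P.HasSharp N` says that `♯P` is well defined and equal to `N`: for all sufficiently small
pushes (the side `i` by `t i > 0` times its normal vector, the `t i` being independent) the pushed
loop `P₊` misses all lattice points, its winding number is nonzero around only finitely many
lattice points, and the sum of its winding numbers over all lattice points is `N`. -/
def HasSharp (P : LatticeMultiPolygon d) (N : ℝ) : Prop :=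
  ∀ᶠ t in 𝓝[{t : Fin d → ℝ | ∀ i, 0 < t i}] 0,
    (∀ u : ℤ × ℤ, latticePt u ∉ P.pushSupport t) ∧
    (Function.support fun u : ℤ × ℤ => P.pushWinding t (latticePt u)).Finite ∧
    ∑ᶠ u : ℤ × ℤ, P.pushWinding t (latticePt u) = N

/-- There is at most one `N` with `P.HasSharp N`. -/
theorem HasSharp.unique {P : LatticeMultiPolygon d} {M N : ℝ} (hM : P.HasSharp M)
    (hN : P.HasSharp N) : M = N := by
  have : (𝓝[{t : Fin d → ℝ | ∀ i, 0 < t i}] 0).NeBot := by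
    have h : Tendsto (fun s : ℝ => fun _ : Fin d => s) (𝓝[>] 0)
        (𝓝[{t : Fin d → ℝ | ∀ i, 0 < t i}] 0) := by
      refine tendsto_nhdsWithin_iff.mpr ⟨?_, ?_⟩
      · exact tendsto_pi_nhds.mpr fun _ => tendsto_id.mono_left nhdsWithin_le_nhds
      · filter_upwards [self_mem_nhdsWithin] with s hs using fun _ => hs
    exact h.neBot
  obtain ⟨t, h1, h2⟩ := (hM.and hN).exists
  exact h1.2.2.symm.trans h2.2.2

/-- `P°`: the same loop with all signs reversed. -/
def opposite (P : LatticeMultiPolygon d) : LatticeMultiPolygon d where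
  vert := P.vert
  sgn i := -P.sgn i
  sgn_eq i h := by rw [P.sgn_eq i h]
  sgn_ne i h := by simpa using P.sgn_ne i h

/-- Dilation preserves incidence of lattice points and segments. -/
theorem latticePt_mem_segment_smul {m : ℕ} (hm : 0 < m) (p q r : ℤ × ℤ) :
    latticePt (m • p) ∈ segment ℝ (latticePt (m • q)) (latticePt (m • r)) ↔
      latticePt p ∈ segment ℝ (latticePt q) (latticePt r) := by
  have hs : ∀ x : ℤ × ℤ, latticePt (m • x) = (m : ℝ) • latticePt x := fun x => by
    apply Complex.ext <;> simp [latticePt]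
  have hm' : (m : ℝ) ≠ 0 := by positivity
  have hi := image_segment ℝ (LinearMap.lsmul ℝ ℂ (m : ℝ)).toAffineMap (latticePt q) (latticePt r)
  simp only [LinearMap.coe_toAffineMap, LinearMap.lsmul_apply] at hi
  simp only [hs, ← hi]
  constructor
  · rintro ⟨x, hx, hxp⟩
    have : x = latticePt p := smul_right_injective ℂ hm' (by simpa using hxp)
    exact this ▸ hx
  · exact fun h => ⟨_, h, by simp⟩

/-- `mP`: the dilation of `P` by a positive integer `m`, with the same signs. -/
def dilate (P : LatticeMultiPolygon d) (m : ℕ) (hm : 0 < m) : LatticeMultiPolygon d where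
  vert i := m • P.vert i
  sgn := P.sgn
  sgn_eq i h := P.sgn_eq i ((latticePt_mem_segment_smul hm _ _ _).mp h)
  sgn_ne i h := P.sgn_ne i (h.imp (latticePt_mem_segment_smul hm _ _ _).mp
    (latticePt_mem_segment_smul hm _ _ _).mp)

end LatticeMultiPolygon

/-!
The proof compares three counts attached to the loop: the area, the lattice sum of winding numbers
of the loop itself, and the lattice sum of winding numbers of the pushed loop.

Let `symAngle u a b` be the signed angle of the segment `[a, b]` seen from `u`, read as zero when
`u` lies on the segment, and let `symWinding` be the corresponding winding number.

*The lattice sum of `symWinding` is exactly the area* (`area_eq_sum`). Under the point reflection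
`u ↦ a + b - u` the function `symAngle · a b` changes sign, and for lattice points `a`, `b` this
reflection preserves the lattice. The lattice sum of `symAngle` itself does not converge, but that
of its second differences `symAngle (u + q) + symAngle (u - q) - 2 * symAngle u` does, since they
decay like `‖u‖⁻³`; by oddness its value is zero (`hasSum_second_difference_symAngle`). Summing over
the sides, the periodization `F q = ∑ u, symWinding (u + q)` satisfies `F q + F (-q) = 2 * F 0`.
Integrating over a unit square gives `∫ symWinding = F 0`
(`integral_eq_sum_of_second_difference`). No triangulation and no area formula is needed.

*Pushing the loop changes the winding numbers of the lattice points by local terms*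
(`tendsto_pushWinding`). As the push tends to zero, a side of sign `ε` gains the angle `ε * π` at its
inner points and `ε * π / 2` at its ends, hence `ε * π` times its lattice length in total
(`sum_angleJump`), which gives `B / 2`. At a vertex, the joining segment sweeps exactly the angle
between the consecutive normal vectors, which are never opposite by the conditions on the signs
(`normal_div_mem_slitPlane`); these angles give `C`. The pushed winding numbers are integers, so
their sum, which tends to `A + B / 2 + C`, is eventually equal to it (`hasSharp`).

The other formulas follow since reversing the signs changes only the sign of `B`, and dilation by
`m` multiplies `A` by `m ^ 2` and `B` by `m` and keeps `C`.
-/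

/-! ### Swept angles -/

/-- The odd version of `sweptAngle`: it agrees with `sweptAngle` off the segment `[a, b]` and is
zero on it, so that it changes sign under the point reflection of the plane that exchanges `a` and
`b`. -/
noncomputable def symAngle (u a b : ℂ) : ℝ := (sweptAngle u a b - sweptAngle u b a) / 2

theorem symAngle_reflect (u a b : ℂ) : symAngle (a + b - u) a b = -symAngle u a b := by
  have h1 : sweptAngle (a + b - u) a b = sweptAngle u b a := by
    unfold sweptAngle
    rw [show b - (a + b - u) = -(a - u) by ring, show a - (a + b - u) = -(b - u) by ring,
      neg_div_neg_eq]
  have h2 : sweptAngle (a + b - u) b a = sweptAngle u a b := by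
    unfold sweptAngle
    rw [show b - (a + b - u) = -(a - u) by ring, show a - (a + b - u) = -(b - u) by ring,
      neg_div_neg_eq]
  unfold symAngle
  rw [h1, h2]; ring

theorem sweptAngle_swap (u a b : ℂ) : sweptAngle u b a = ((b - u) / (a - u))⁻¹.arg := by
  rw [inv_div]; rfl

theorem symAngle_eq_sweptAngle_of_ne_pi {u a b : ℂ} (h : sweptAngle u a b ≠ Real.pi) :
    symAngle u a b = sweptAngle u a b := by
  unfold symAngle
  rw [sweptAngle_swap u a b, Complex.arg_inv]
  unfold sweptAngle at h ⊢
  rw [if_neg h]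
  ring

theorem abs_sweptAngle_le (u a b : ℂ) : |sweptAngle u a b| ≤ Real.pi := Complex.abs_arg_le_pi _

theorem abs_symAngle_le (u a b : ℂ) : |symAngle u a b| ≤ Real.pi := by
  have h1 := abs_le.mp (abs_sweptAngle_le u a b)
  have h2 := abs_le.mp (abs_sweptAngle_le u b a)
  unfold symAngle
  rw [abs_le]
  constructor <;> linarith [h1.1, h1.2, h2.1, h2.2]

theorem measurable_sweptAngle (a b : ℂ) : Measurable fun u => sweptAngle u a b := by
  unfold sweptAngle
  exact Complex.measurable_arg.comp (by fun_prop)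

theorem measurable_symAngle (a b : ℂ) : Measurable fun u => symAngle u a b :=
  ((measurable_sweptAngle a b).sub (measurable_sweptAngle b a)).div_const 2

/-- If the quotient of the two end vectors is not in `(-∞, 0]`, the segment misses `u`. -/
theorem notMem_segment_of_mem_slitPlane {u a b : ℂ} (h : (b - u) / (a - u) ∈ Complex.slitPlane) :
    u ∉ segment ℝ a b := by
  intro hu
  rw [segment_eq_image'] at hu
  obtain ⟨s, ⟨hs0, hs1⟩, rfl⟩ := hu
  rw [Complex.mem_slitPlane_iff_not_le_zero] at h
  apply h
  simp only [Complex.real_smul]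
  rcases eq_or_ne s 0 with rfl | hs
  · simp
  rcases eq_or_ne a b with rfl | hab
  · simp
  have hab' : b - a ≠ 0 := sub_ne_zero.mpr hab.symm
  have hsc : (s : ℂ) ≠ 0 := by exact_mod_cast hs
  have : (b - (a + s * (b - a))) / (a - (a + s * (b - a))) = ((-((1 - s) / s) : ℝ) : ℂ) := by
    rw [div_eq_iff (by
      rw [show a - (a + s * (b - a)) = -(s * (b - a)) by ring]
      exact neg_ne_zero.mpr (mul_ne_zero hsc hab'))]
    push_cast
    field_simp
    ring
  rw [this]
  have h0 : -((1 - s) / s) ≤ 0 := neg_nonpos.mpr (div_nonneg (by linarith) hs0)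
  exact_mod_cast h0

theorem mem_slitPlane_of_notMem_segment {u a b : ℂ} (h : u ∉ segment ℝ a b) :
    (b - u) / (a - u) ∈ Complex.slitPlane := by
  rw [Complex.mem_slitPlane_iff_not_le_zero]
  intro hle
  have ha : a - u ≠ 0 := fun h0 => h (by
    rw [← sub_eq_zero.mp h0]; exact left_mem_segment ℝ _ _)
  obtain ⟨h1, h2⟩ := Complex.le_def.mp hle
  obtain ⟨r, hr, hq⟩ : ∃ r : ℝ, 0 ≤ r ∧ (b - u) / (a - u) = ((-r : ℝ) : ℂ) :=
    ⟨-((b - u) / (a - u)).re, by simpa using h1, Complex.ext (by simp) (by simpa using h2)⟩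
  rw [div_eq_iff ha] at hq
  apply h
  rw [segment_eq_image']
  have h1r : (0 : ℝ) < 1 + r := by linarith
  have h1c : ((1 : ℂ) + r) ≠ 0 := by exact_mod_cast h1r.ne'
  refine ⟨1 / (1 + r), ⟨by positivity, ?_⟩, ?_⟩
  · rw [div_le_one h1r]; linarith
  · simp only [Complex.real_smul]
    push_cast at hq ⊢
    field_simp
    linear_combination hq

theorem sweptAngle_ne_pi_of_notMem_segment {u a b : ℂ} (h : u ∉ segment ℝ a b) :
    sweptAngle u a b ≠ Real.pi :=
  Complex.slitPlane_arg_ne_pi (mem_slitPlane_of_notMem_segment h)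

theorem symAngle_eq_sweptAngle {u a b : ℂ} (h : u ∉ segment ℝ a b) :
    symAngle u a b = sweptAngle u a b :=
  symAngle_eq_sweptAngle_of_ne_pi (sweptAngle_ne_pi_of_notMem_segment h)

theorem symAngle_eq_zero {u a b : ℂ} (h : u ∈ segment ℝ a b) : symAngle u a b = 0 := by
  have key : ∀ a b : ℂ, u ∈ segment ℝ a b → sweptAngle u a b = sweptAngle u b a := by
    intro a b h
    by_cases hpi : sweptAngle u a b = Real.pi
    · rw [sweptAngle_swap u a b, Complex.arg_inv]
      exact hpi.trans (if_pos hpi).symm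
    · have hz : (b - u) / (a - u) = 0 := by
        by_contra hz
        exact notMem_segment_of_mem_slitPlane (Complex.mem_slitPlane_iff_arg.mpr ⟨hpi, hz⟩) h
      rw [sweptAngle_swap u a b, hz]
      simp [sweptAngle, hz]
  rw [symAngle, key a b h, sub_self, zero_div]

theorem sweptAngle_real_mul {r : ℝ} (hr : 0 < r) (a b : ℂ) :
    sweptAngle 0 (r * a) (r * b) = sweptAngle 0 a b := by
  have hr' : (r : ℂ) ≠ 0 := by exact_mod_cast hr.ne'
  simp only [sweptAngle, sub_zero, mul_div_mul_left _ _ hr']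

/-! ### Points far from the loop -/

/-- Seen from a point `x` farther from the origin than `a` and `b`, the swept angle is a
difference of values of a continuous branch of the angle. -/
theorem sweptAngle_eq_of_norm_lt {x a b : ℂ} (ha : ‖a‖ < ‖x‖) (hb : ‖b‖ < ‖x‖) :
    sweptAngle x a b = (1 - b / x).arg - (1 - a / x).arg := by
  have hx : x ≠ 0 := norm_pos_iff.mp ((norm_nonneg a).trans_lt ha)
  have key : ∀ c : ℂ, ‖c‖ < ‖x‖ → 0 < (1 - c / x).re := by
    intro c hc
    have : ‖c / x‖ < 1 := by rwa [norm_div, div_lt_one (norm_pos_iff.mpr hx)]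
    have := (Complex.re_le_norm (c / x)).trans_lt this
    simpa using this
  have hne : ∀ c : ℂ, ‖c‖ < ‖x‖ → 1 - c / x ≠ 0 := fun c hc h0 => by
    have := key c hc; rw [h0] at this; simp at this
  have h1 := abs_lt.mp (Complex.abs_arg_lt_pi_div_two_iff.mpr (Or.inl (key a ha)))
  have h2 := abs_lt.mp (Complex.abs_arg_lt_pi_div_two_iff.mpr (Or.inl (key b hb)))
  have hpi : (1 - a / x).arg ≠ Real.pi := fun h => by linarith [h1.2, Real.pi_pos]
  have e : (b - x) / (a - x) = (1 - b / x) * (1 - a / x)⁻¹ := by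
    have h3 : a - x ≠ 0 := fun h => ha.ne (by rw [sub_eq_zero.mp h])
    have h4 := hne a ha
    have e1 : b - x = -x * (1 - b / x) := by field_simp; ring
    have e2 : a - x = -x * (1 - a / x) := by field_simp; ring
    rw [e1, e2, mul_div_mul_left _ _ (neg_ne_zero.mpr hx), div_eq_mul_inv]
  have hinv : ((1 - a / x)⁻¹).arg = -(1 - a / x).arg := by rw [Complex.arg_inv, if_neg hpi]
  rw [sweptAngle, e, Complex.arg_mul (hne b hb) (inv_ne_zero (hne a ha)), hinv]
  · ring
  rw [hinv]
  constructor <;> linarith [h1.1, h1.2, h2.1, h2.2]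

theorem symAngle_eq_of_norm_lt {x a b : ℂ} (ha : ‖a‖ < ‖x‖) (hb : ‖b‖ < ‖x‖) :
    symAngle x a b = (1 - b / x).arg - (1 - a / x).arg := by
  rw [symAngle, sweptAngle_eq_of_norm_lt ha hb, sweptAngle_eq_of_norm_lt hb ha]; ring

theorem sum_fin_succ_eq {d : ℕ} [NeZero d] {M : Type*} [AddCommMonoid M] (f : Fin d → M) :
    ∑ i, f (i + 1) = ∑ i, f i := Equiv.sum_comp (Equiv.addRight (1 : Fin d)) f

/-! ### Pushing a side off the lattice -/

/-- The jump of the angle swept by a side, as seen from `u`, when the side is pushed slightly to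
its right: `π` from inner points of the side, `π / 2` from its ends, and zero elsewhere. -/
noncomputable def angleJump (u a b : ℂ) : ℝ :=
  open Classical in
  (if u ∈ segment ℝ a b then Real.pi else 0) - (if u = a then Real.pi / 2 else 0) -
    (if u = b then Real.pi / 2 else 0)

theorem tendsto_ofReal_nhdsGT : Tendsto (fun t : ℝ => (t : ℂ)) (𝓝[>] 0) (𝓝 0) :=
  (Complex.continuous_ofReal.tendsto' 0 0 (by simp)).mono_left nhdsWithin_le_nhds

theorem tendsto_apply_push {n : ℕ} (i : Fin n) :
    Tendsto (fun t : Fin n → ℝ => t i) (𝓝[{t : Fin n → ℝ | ∀ i, 0 < t i}] 0) (𝓝[>] 0) := by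
  refine tendsto_nhdsWithin_iff.mpr ⟨?_, ?_⟩
  · exact ((continuous_apply i).tendsto' 0 0 rfl).mono_left nhdsWithin_le_nhds
  · filter_upwards [self_mem_nhdsWithin] with t ht using ht i

theorem tendsto_quotient_slitPlane {α : Type*} {l : Filter α} {u a b : ℂ} {f g : α → ℂ}
    (hu : u ∉ segment ℝ a b) (hf : Tendsto f l (𝓝 a)) (hg : Tendsto g l (𝓝 b)) :
    (∀ᶠ t in l, u ∉ segment ℝ (f t) (g t)) ∧
      Tendsto (fun t => sweptAngle u (f t) (g t)) l (𝓝 (sweptAngle u a b)) := by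
  have ha : a - u ≠ 0 := fun h0 => hu (by
    rw [← sub_eq_zero.mp h0]; exact left_mem_segment ℝ _ _)
  have hs := mem_slitPlane_of_notMem_segment hu
  have hlim : Tendsto (fun t => (g t - u) / (f t - u)) l (𝓝 ((b - u) / (a - u))) :=
    (hg.sub_const u).div (hf.sub_const u) ha
  refine ⟨?_, (Complex.continuousAt_arg hs).tendsto.comp hlim⟩
  filter_upwards [hlim.eventually (Complex.isOpen_slitPlane.mem_nhds hs)] with t ht
  exact notMem_segment_of_mem_slitPlane ht

/-- Up to a positive factor, the quotient of the end vectors of a pushed side, seen from the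
point that divides the side in the ratio `s : 1 - s`. -/
theorem pushed_quotient {e : ℂ} (he : e * e = 1) {a b : ℂ} (hab : a ≠ b) (s t : ℝ) (ht : 0 < t)
    (hreal : ∃ r : ℝ, e = r) :
    ∃ c : ℝ, 0 < c ∧ ((b + t * (e * (-Complex.I * (b - a))) - (a + s * (b - a))) /
      (a + t * (e * (-Complex.I * (b - a))) - (a + s * (b - a)))) =
        c * (((t ^ 2 - s * (1 - s) : ℝ) : ℂ) + t * e * Complex.I) := by
  obtain ⟨r, rfl⟩ := hreal
  have hab' : b - a ≠ 0 := sub_ne_zero.mpr hab.symm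
  have hr : r * r = 1 := by exact_mod_cast he
  have hc : 0 < s ^ 2 + t ^ 2 := by positivity
  have hcc : (s : ℂ) ^ 2 + (t : ℂ) ^ 2 ≠ 0 := by exact_mod_cast hc.ne'
  have hfac : ((s : ℂ) + t * r * Complex.I) * (s - t * r * Complex.I) = s ^ 2 + t ^ 2 := by
    linear_combination (-(t : ℂ) ^ 2 * r ^ 2) * Complex.I_mul_I + (t : ℂ) ^ 2 * he
  have hne : (s : ℂ) + t * r * Complex.I ≠ 0 := fun h0 => hcc (by rw [← hfac, h0, zero_mul])
  refine ⟨(s ^ 2 + t ^ 2)⁻¹, by positivity, ?_⟩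
  have e1 : b + t * (r * (-Complex.I * (b - a))) - (a + s * (b - a)) =
      (b - a) * (1 - s - t * r * Complex.I) := by ring
  have e2 : a + t * (r * (-Complex.I * (b - a))) - (a + s * (b - a)) =
      (b - a) * (-(s + t * r * Complex.I)) := by ring
  rw [e1, e2, mul_div_mul_left _ _ hab', div_eq_iff (neg_ne_zero.mpr hne)]
  push_cast
  field_simp
  linear_combination (t ^ 2 * (r : ℂ) ^ 2) * Complex.I_mul_I - (t : ℂ) ^ 2 * he

/-- The angle swept by a pushed side, as the push tends to zero: the angle swept by the side
itself, corrected at the points of the side. The push is along the normal vector of sign `e`. -/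
theorem tendsto_sweptAngle_push (e : ℤˣ) {a b : ℂ} (hab : a ≠ b) (u : ℂ) :
    (∀ᶠ t : ℝ in 𝓝[>] 0, u ∉ segment ℝ (a + t * (((e : ℤ) : ℂ) * (-Complex.I * (b - a))))
        (b + t * (((e : ℤ) : ℂ) * (-Complex.I * (b - a))))) ∧
      Tendsto (fun t : ℝ => sweptAngle u (a + t * (((e : ℤ) : ℂ) * (-Complex.I * (b - a))))
        (b + t * (((e : ℤ) : ℂ) * (-Complex.I * (b - a))))) (𝓝[>] 0)
        (𝓝 (symAngle u a b + (e : ℤ) * angleJump u a b)) := by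
  by_cases hu : u ∈ segment ℝ a b
  swap
  · have hlim : ∀ c : ℂ, Tendsto (fun t : ℝ => c + t * (((e : ℤ) : ℂ) * (-Complex.I * (b - a))))
        (𝓝[>] 0) (𝓝 c) := fun c => by
      simpa using (tendsto_ofReal_nhdsGT.mul_const
        (((e : ℤ) : ℂ) * (-Complex.I * (b - a)))).const_add c
    have hua : u ≠ a := fun h => hu (h ▸ left_mem_segment ℝ _ _)
    have hub : u ≠ b := fun h => hu (h ▸ right_mem_segment ℝ _ _)
    rw [symAngle_eq_sweptAngle hu, angleJump, if_neg hu, if_neg hua, if_neg hub]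
    simp only [sub_zero, mul_zero, add_zero]
    exact tendsto_quotient_slitPlane hu (hlim a) (hlim b)
  · have hsym := symAngle_eq_zero hu
    have hu' := hu
    rw [segment_eq_image'] at hu
    obtain ⟨s, ⟨hs0, hs1⟩, hus⟩ := hu
    simp only [Complex.real_smul] at hus
    have hq := fun (t : ℝ) (ht : 0 < t) => pushed_quotient (e := ((e : ℤ) : ℂ))
      (by norm_cast; rw [Int.units_mul_self]; rfl) hab s t ht ⟨(e : ℤ), by simp⟩
    rw [hus] at hq
    have hej : ∀ t : ℝ, 0 < t → (((t ^ 2 - s * (1 - s) : ℝ) : ℂ) + t * ((e : ℤ) : ℂ) * Complex.I) =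
        ⟨t ^ 2 - s * (1 - s), t * (e : ℤ)⟩ := fun t _ => by
      apply Complex.ext <;> simp [← Complex.ofReal_intCast, -Complex.ofReal_sub,
        -Complex.ofReal_pow, -Complex.ofReal_mul]
    have hene : ((e : ℤ) : ℝ) ≠ 0 := by exact_mod_cast e.ne_zero
    refine ⟨?_, ?_⟩
    · filter_upwards [self_mem_nhdsWithin] with t (ht : 0 < t)
      apply notMem_segment_of_mem_slitPlane
      obtain ⟨c, hc, h⟩ := hq t ht
      rw [h, hej t ht, Complex.mem_slitPlane_iff]
      right
      simp [hc.ne', ht.ne', hene]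
    · have harg : ∀ᶠ t : ℝ in 𝓝[>] 0, Complex.arg ⟨t ^ 2 - s * (1 - s), t * (e : ℤ)⟩ =
          sweptAngle u (a + t * (((e : ℤ) : ℂ) * (-Complex.I * (b - a))))
            (b + t * (((e : ℤ) : ℂ) * (-Complex.I * (b - a)))) := by
        filter_upwards [self_mem_nhdsWithin] with t (ht : 0 < t)
        obtain ⟨c, hc, h⟩ := hq t ht
        rw [sweptAngle, h, hej t ht, Complex.arg_real_mul _ hc]
      refine Tendsto.congr' harg ?_
      rw [hsym, zero_add]
      have hba : b - a ≠ 0 := sub_ne_zero.mpr hab.symm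
      have hua : u = a ↔ s = 0 := by
        rw [← hus, add_eq_left, mul_eq_zero]; simp [hba]
      have hub : u = b ↔ s = 1 := by
        rw [← hus, ← sub_eq_zero, show a + s * (b - a) - b = (s - 1) * (b - a) by ring, mul_eq_zero,
          or_iff_left hba, sub_eq_zero]
        norm_cast
      by_cases hend : s * (1 - s) = 0
      · -- at an end of the side the quotient is a positive multiple of `t ± i`
        have hj : angleJump u a b = Real.pi / 2 := by
          rw [angleJump, if_pos hu']
          rcases mul_eq_zero.mp hend with h | h
          · rw [if_pos (hua.mpr h), if_neg (fun h' => by have := hub.mp h'; linarith)]; ring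
          · rw [if_pos (hub.mpr (by linarith)), if_neg (fun h' => by have := hua.mp h'; linarith)]
            ring
        rw [hj, hend]
        have h1 : ∀ᶠ t : ℝ in 𝓝[>] 0, Complex.arg (t + (e : ℤ) * Complex.I) =
            Complex.arg ⟨t ^ 2 - 0, t * (e : ℤ)⟩ := by
          filter_upwards [self_mem_nhdsWithin] with t (ht : 0 < t)
          rw [← Complex.arg_real_mul _ ht]
          congr 1
          apply Complex.ext <;> simp [pow_two]
        refine Tendsto.congr' h1 ?_
        have h2 : Complex.arg (0 + (e : ℤ) * Complex.I) = (e : ℤ) * (Real.pi / 2) := by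
          rcases Int.units_eq_one_or e with rfl | rfl
          · simp
          · simp [Complex.arg_neg_I]
        rw [← h2]
        refine (Complex.continuousAt_arg ?_).tendsto.comp (tendsto_ofReal_nhdsGT.add_const _)
        rw [Complex.mem_slitPlane_iff]
        right
        simp [hene]
      · have hpos : 0 < s * (1 - s) :=
          lt_of_le_of_ne (mul_nonneg hs0 (by linarith)) (Ne.symm hend)
        have hj : angleJump u a b = Real.pi := by
          rw [angleJump, if_pos hu', if_neg (fun h => hend (by rw [hua.mp h, zero_mul])),
            if_neg (fun h => hend (by rw [hub.mp h, sub_self, mul_zero]))]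
          ring
        rw [hj]
        have hc : Tendsto (fun t : ℝ => (⟨t ^ 2 - s * (1 - s), t * (e : ℤ)⟩ : ℂ)) (𝓝[>] 0)
            (𝓝 ((-(s * (1 - s)) : ℝ) : ℂ)) := by
          have : Continuous fun t : ℝ => (⟨t ^ 2 - s * (1 - s), t * (e : ℤ)⟩ : ℂ) :=
            Complex.equivRealProdCLM.symm.continuous.comp
              (f := fun t : ℝ => (t ^ 2 - s * (1 - s), t * ((e : ℤ) : ℝ))) (by fun_prop)
          refine (this.tendsto' 0 _ ?_).mono_left nhdsWithin_le_nhds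
          apply Complex.ext <;> simp
        have hre : ((-(s * (1 - s)) : ℝ) : ℂ).re < 0 := by rw [Complex.ofReal_re]; linarith
        rcases Int.units_eq_one_or e with rfl | rfl
        · have := (Complex.continuousWithinAt_arg_of_re_neg_of_im_zero hre
            (Complex.ofReal_im _)).tendsto
          rw [Complex.arg_ofReal_of_neg (by linarith)] at this
          simp only [Units.val_one, Int.cast_one, one_mul]
          refine this.comp (tendsto_nhdsWithin_iff.mpr ⟨by simpa using hc, ?_⟩)
          filter_upwards [self_mem_nhdsWithin] with t (ht : 0 < t)
          simpa using ht.le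
        · have := Complex.tendsto_arg_nhdsWithin_im_neg_of_re_neg_of_im_zero hre
            (Complex.ofReal_im _)
          simp only [Units.val_neg, Units.val_one, Int.cast_neg, Int.cast_one, neg_mul, one_mul]
          refine this.comp (tendsto_nhdsWithin_iff.mpr ⟨by simpa using hc, ?_⟩)
          filter_upwards [self_mem_nhdsWithin] with t (ht : 0 < t)
          simpa using ht

/-! ### Second differences of swept angles -/

theorem abs_arg_one_add_le {z : ℂ} (hz : ‖z‖ ≤ 1 / 2) : |(1 + z).arg| ≤ 3 / 2 * ‖z‖ := by
  rw [← Complex.log_im]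
  exact (Complex.abs_im_le_norm _).trans (Complex.norm_log_one_add_half_le_self hz)

/-- Far from the origin the angle swept by a fixed segment is a harmonic function with second
derivatives of order `‖x‖⁻³`. The proof bounds the second difference as the argument of one
quotient close to `1`. -/
theorem abs_second_difference_symAngle_le {a b q x : ℂ} (hx : 0 < ‖x‖)
    (hab : 10 * (‖a‖ + ‖b‖ + ‖q‖) ≤ ‖x‖) :
    |symAngle (x + q) a b + symAngle (x - q) a b - 2 * symAngle x a b| ≤
      6 * ‖q‖ ^ 2 * ‖b - a‖ * (‖x‖ ^ 3)⁻¹ := by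
  have ha0 := norm_nonneg a
  have hb0 := norm_nonneg b
  have hq0 := norm_nonneg q
  have hba : ‖b - a‖ ≤ ‖x‖ / 10 := (norm_sub_le b a).trans (by linarith)
  have hlow : ∀ c q' : ℂ, ‖c‖ + ‖q'‖ ≤ ‖x‖ / 10 → 9 / 10 * ‖x‖ ≤ ‖c - (x + q')‖ := by
    intro c q' h
    have h1 := norm_sub_le (c - (x + q')) (c - q')
    rw [show c - (x + q') - (c - q') = -x by ring, norm_neg] at h1
    have h2 := norm_sub_le c q'
    linarith
  -- each of the three quotients is close to `1`
  have key : ∀ q' : ℂ, ‖q'‖ ≤ ‖q‖ → symAngle (x + q') a b = ((b - (x + q')) / (a - (x + q'))).arg ∧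
      |((b - (x + q')) / (a - (x + q'))).arg| ≤ 1 / 6 ∧ a - (x + q') ≠ 0 ∧
        b - (x + q') ≠ 0 := by
    intro q' hq'
    have hA := hlow a q' (by linarith)
    have hB := hlow b q' (by linarith)
    have hA' : a - (x + q') ≠ 0 := norm_pos_iff.mp (by linarith)
    have hB' : b - (x + q') ≠ 0 := norm_pos_iff.mp (by linarith)
    have e : (b - (x + q')) / (a - (x + q')) = 1 + (b - a) / (a - (x + q')) := by
      field_simp; ring
    have hz : ‖(b - a) / (a - (x + q'))‖ ≤ 1 / 9 := by
      rw [norm_div, div_le_iff₀ (by linarith)]; linarith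
    have harg : |((b - (x + q')) / (a - (x + q'))).arg| ≤ 1 / 6 := by
      rw [e]; exact (abs_arg_one_add_le (by linarith)).trans (by linarith)
    refine ⟨symAngle_eq_sweptAngle_of_ne_pi fun h => ?_, harg, hA', hB'⟩
    rw [sweptAngle] at h
    rw [h, abs_of_pos Real.pi_pos] at harg
    linarith [Real.pi_gt_three]
  obtain ⟨e1, b1, n1, m1⟩ := key q le_rfl
  obtain ⟨e2, b2, n2, m2⟩ := key (-q) (by rw [norm_neg])
  obtain ⟨e3, b3, n3, m3⟩ := key 0 (by simp)
  have l1 := hlow a q (by linarith)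
  have l2 := hlow a (-q) (by rw [norm_neg]; linarith)
  have l3 := hlow b 0 (by rw [norm_zero]; linarith)
  rw [← sub_eq_add_neg] at e2 b2 n2 m2 l2
  rw [add_zero] at e3 b3 n3 m3 l3
  rw [e1, e2, e3]
  set A1 := (b - (x + q)) / (a - (x + q)) with hA1
  set A2 := (b - (x - q)) / (a - (x - q)) with hA2
  set A3 := (b - x) / (a - x) with hA3
  have hA1n : A1 ≠ 0 := div_ne_zero m1 n1
  have hA2n : A2 ≠ 0 := div_ne_zero m2 n2
  have hA3n : A3 ≠ 0 := div_ne_zero m3 n3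
  have hpi := Real.pi_gt_three
  have b1' := abs_le.mp b1
  have b2' := abs_le.mp b2
  have b3' := abs_le.mp b3
  have hinv : A3⁻¹.arg = -A3.arg := by
    rw [Complex.arg_inv, if_neg]; intro h; linarith [b3'.2]
  have h12 : (A1 * A2).arg = A1.arg + A2.arg :=
    Complex.arg_mul hA1n hA2n ⟨by linarith [b1'.1, b2'.1], by linarith [b1'.2, b2'.2]⟩
  have h33 : (A3⁻¹ * A3⁻¹).arg = -A3.arg + -A3.arg := by
    rw [Complex.arg_mul (inv_ne_zero hA3n) (inv_ne_zero hA3n), hinv]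
    rw [hinv]; constructor <;> linarith [b3'.1, b3'.2]
  have hall : (A1 * A2 * (A3⁻¹ * A3⁻¹)).arg = A1.arg + A2.arg - 2 * A3.arg := by
    rw [Complex.arg_mul (mul_ne_zero hA1n hA2n)
      (mul_ne_zero (inv_ne_zero hA3n) (inv_ne_zero hA3n)), h12, h33]
    · ring
    · rw [h12, h33]
      constructor <;> linarith [b1'.1, b2'.1, b1'.2, b2'.2, b3'.1, b3'.2]
  rw [← hall]
  have hZ : A1 * A2 * (A3⁻¹ * A3⁻¹) = 1 + q ^ 2 * (b - a) * ((b - x) + (a - x)) /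
      ((b - x) ^ 2 * ((a - (x + q)) * (a - (x - q)))) := by
    rw [hA1, hA2, hA3]
    field_simp
    ring
  rw [hZ]
  have hx3 : 0 < ‖x‖ ^ 3 := by positivity
  have hnum : ‖(b - x) + (a - x)‖ ≤ 11 / 5 * ‖x‖ := by
    have t1 := norm_add_le (b - x) (a - x)
    have t2 := norm_sub_le b x
    have t3 := norm_sub_le a x
    linarith
  have hden : 6 / 10 * ‖x‖ ^ 4 ≤ ‖(b - x) ^ 2 * ((a - (x + q)) * (a - (x - q)))‖ := by
    rw [norm_mul, norm_mul, norm_pow]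
    calc 6 / 10 * ‖x‖ ^ 4 ≤ (9 / 10 * ‖x‖) ^ 2 * ((9 / 10 * ‖x‖) * (9 / 10 * ‖x‖)) := by
          nlinarith [pow_pos hx 4]
      _ ≤ _ := by gcongr
  have hbound : ‖q ^ 2 * (b - a) * ((b - x) + (a - x)) /
      ((b - x) ^ 2 * ((a - (x + q)) * (a - (x - q))))‖ ≤ 4 * ‖q‖ ^ 2 * ‖b - a‖ * (‖x‖ ^ 3)⁻¹ := by
    rw [norm_div, norm_mul, norm_mul, norm_pow]
    calc _ ≤ ‖q‖ ^ 2 * ‖b - a‖ * (11 / 5 * ‖x‖) / (6 / 10 * ‖x‖ ^ 4) := by gcongr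
      _ = 11 / 3 * (‖q‖ ^ 2 * ‖b - a‖ * (‖x‖ ^ 3)⁻¹) := by field_simp; ring
      _ ≤ 4 * (‖q‖ ^ 2 * ‖b - a‖ * (‖x‖ ^ 3)⁻¹) := by gcongr; norm_num
      _ = _ := by ring
  have hsmall : 4 * ‖q‖ ^ 2 * ‖b - a‖ * (‖x‖ ^ 3)⁻¹ ≤ 1 / 2 := by
    rw [← div_eq_mul_inv, div_le_iff₀ hx3]
    calc 4 * ‖q‖ ^ 2 * ‖b - a‖ ≤ 4 * (‖x‖ / 10) ^ 2 * (‖x‖ / 10) := by gcongr; linarith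
      _ ≤ _ := by nlinarith
  refine (abs_arg_one_add_le (hbound.trans hsmall)).trans ?_
  linarith

/-! ### Sums over the lattice -/

theorem latticePt_add (u v : ℤ × ℤ) : latticePt (u + v) = latticePt u + latticePt v := by
  apply Complex.ext <;> simp [latticePt]

theorem latticePt_neg (u : ℤ × ℤ) : latticePt (-u) = -latticePt u := by
  apply Complex.ext <;> simp [latticePt]

theorem latticePt_sub (u v : ℤ × ℤ) : latticePt (u - v) = latticePt u - latticePt v := by
  rw [sub_eq_add_neg, latticePt_add, latticePt_neg, sub_eq_add_neg]

theorem latticePt_injective : Function.Injective latticePt := by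
  intro u v h
  have h1 := congrArg Complex.re h
  have h2 := congrArg Complex.im h
  simp only [latticePt] at h1 h2
  exact Prod.ext (by exact_mod_cast h1) (by exact_mod_cast h2)

theorem norm_le_norm_latticePt (u : ℤ × ℤ) : ‖u‖ ≤ ‖latticePt u‖ := by
  rw [Prod.norm_def, Int.norm_eq_abs, Int.norm_eq_abs]
  exact max_le (Complex.abs_re_le_norm (latticePt u)) (Complex.abs_im_le_norm (latticePt u))

theorem finite_norm_latticePt_le (R : ℝ) : {u : ℤ × ℤ | ‖latticePt u‖ ≤ R}.Finite := by
  refine ((isCompact_closedBall (0 : ℤ × ℤ) R).finite_of_discrete).subset fun u hu => ?_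
  rw [mem_closedBall_zero_iff]
  exact (norm_le_norm_latticePt u).trans hu

theorem summable_norm_latticePt : Summable fun u : ℤ × ℤ => (‖latticePt u‖ ^ 3)⁻¹ := by
  have h := EisensteinSeries.summable_one_div_norm_rpow (k := 3) (by norm_num)
  rw [← (finTwoArrowEquiv _).symm.summable_iff] at h
  refine h.of_norm_bounded_eventually ?_
  have hfin : {u : ℤ × ℤ | u = 0}.Finite := by simp
  filter_upwards [hfin.compl_mem_cofinite] with u hu
  have hu' : u ≠ 0 := hu
  have hle : ‖(finTwoArrowEquiv ℤ).symm u‖ ≤ ‖latticePt u‖ := by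
    rw [pi_norm_le_iff_of_nonneg (norm_nonneg _), Fin.forall_fin_two]
    refine ⟨le_trans ?_ (norm_le_norm_latticePt u), le_trans ?_ (norm_le_norm_latticePt u)⟩
    · exact norm_fst_le u
    · exact norm_snd_le u
  have hpos : 0 < ‖(finTwoArrowEquiv ℤ).symm u‖ := norm_pos_iff.mpr fun h => hu' (by
    have := congrArg (finTwoArrowEquiv ℤ) h
    rwa [Equiv.apply_symm_apply] at this)
  rw [Function.comp_apply, Real.rpow_neg hpos.le, norm_inv, norm_pow, norm_norm,
    show (3 : ℝ) = (3 : ℕ) by norm_num, Real.rpow_natCast]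
  gcongr

/-- The second differences of `symAngle` in a fixed direction sum to zero over the lattice: they
are summable, and odd under the reflection of the lattice that exchanges the two ends. -/
theorem hasSum_second_difference_symAngle (p r : ℤ × ℤ) (q : ℂ) :
    HasSum (fun u : ℤ × ℤ => symAngle (latticePt u + q) (latticePt p) (latticePt r) +
      symAngle (latticePt u - q) (latticePt p) (latticePt r) -
        2 * symAngle (latticePt u) (latticePt p) (latticePt r)) 0 := by
  set f := fun u : ℤ × ℤ => symAngle (latticePt u + q) (latticePt p) (latticePt r) +
      symAngle (latticePt u - q) (latticePt p) (latticePt r) -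
        2 * symAngle (latticePt u) (latticePt p) (latticePt r) with hf
  have hs : Summable f := by
    refine (summable_norm_latticePt.mul_left
      (6 * ‖q‖ ^ 2 * ‖latticePt r - latticePt p‖)).of_norm_bounded_eventually ?_
    filter_upwards [(finite_norm_latticePt_le
      (10 * (‖latticePt p‖ + ‖latticePt r‖ + ‖q‖))).compl_mem_cofinite] with u hu
    have hu' : 10 * (‖latticePt p‖ + ‖latticePt r‖ + ‖q‖) < ‖latticePt u‖ := not_le.mp hu
    exact abs_second_difference_symAngle_le (lt_of_le_of_lt (by positivity) hu') hu'.le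
  have hodd : ∀ u, f (Equiv.subLeft (p + r) u) = -f u := by
    intro u
    simp only [hf, Equiv.subLeft_apply, latticePt_sub, latticePt_add]
    rw [show latticePt p + latticePt r - latticePt u + q =
        latticePt p + latticePt r - (latticePt u - q) by ring,
      show latticePt p + latticePt r - latticePt u - q =
        latticePt p + latticePt r - (latticePt u + q) by ring,
      symAngle_reflect, symAngle_reflect, symAngle_reflect]
    ring
  have h0 : ∑' u, f u = -∑' u, f u := by
    rw [← tsum_neg, ← (Equiv.subLeft (p + r)).tsum_eq f]
    exact tsum_congr hodd
  have h1 : ∑' u, f u = 0 := by linarith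
  rw [← h1]
  exact hs.hasSum

/-- The half-open unit square with lower left corner `u`. -/
def unitSquare (u : ℤ × ℤ) : Set ℂ :=
  Set.Ico (u.1 : ℝ) (u.1 + 1) ×ℂ Set.Ico (u.2 : ℝ) (u.2 + 1)

theorem measurableSet_unitSquare (u : ℤ × ℤ) : MeasurableSet (unitSquare u) :=
  (Complex.measurable_re measurableSet_Ico).inter (Complex.measurable_im measurableSet_Ico)

theorem mem_unitSquare {u : ℤ × ℤ} {x : ℂ} : x ∈ unitSquare u ↔ (⌊x.re⌋, ⌊x.im⌋) = u := by
  rw [unitSquare, Complex.mem_reProdIm, Set.mem_Ico, Set.mem_Ico, Prod.ext_iff, Int.floor_eq_iff,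
    Int.floor_eq_iff]

theorem volume_unitSquare (u : ℤ × ℤ) : volume (unitSquare u) = 1 := by
  have : unitSquare u = Complex.measurableEquivRealProd ⁻¹'
      (Set.Ico (u.1 : ℝ) (u.1 + 1) ×ˢ Set.Ico (u.2 : ℝ) (u.2 + 1)) := by
    ext x; rfl
  rw [this, Complex.volume_preserving_equiv_real_prod.measure_preimage
    (measurableSet_Ico.prod measurableSet_Ico).nullMeasurableSet, Measure.volume_eq_prod,
    Measure.prod_prod]
  simp

theorem norm_lt_two_of_mem_unitSquare {x : ℂ} (hx : x ∈ unitSquare 0) : ‖x‖ < 2 := by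
  rw [unitSquare, Complex.mem_reProdIm] at hx
  simp only [Prod.fst_zero, Prod.snd_zero, Int.cast_zero, zero_add, Set.mem_Ico] at hx
  refine (Complex.norm_le_abs_re_add_abs_im x).trans_lt ?_
  rw [abs_of_nonneg hx.1.1, abs_of_nonneg hx.2.1]
  linarith [hx.1.2, hx.2.2]

theorem hasSum_setIntegral_unitSquare {f : ℂ → ℝ} (hf : Integrable f) :
    HasSum (fun u : ℤ × ℤ => ∫ x in unitSquare 0, f (x + latticePt u)) (∫ x, f x) := by
  have hU : (⋃ u, unitSquare u) = Set.univ :=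
    Set.eq_univ_of_forall fun x => Set.mem_iUnion.mpr ⟨_, mem_unitSquare.mpr rfl⟩
  have hd : Pairwise (Function.onFun Disjoint unitSquare) := by
    intro u v huv
    refine Set.disjoint_left.mpr fun x hx hx' => huv ?_
    rw [← mem_unitSquare.mp hx, ← mem_unitSquare.mp hx']
  have h := hasSum_integral_iUnion measurableSet_unitSquare hd hf.integrableOn
  rw [hU, setIntegral_univ] at h
  refine h.congr_fun fun u => ?_
  have hpre : unitSquare 0 = (fun x : ℂ => x + latticePt u) ⁻¹' unitSquare u := by
    ext x
    simp only [Set.mem_preimage, mem_unitSquare, latticePt, Complex.add_re, Complex.add_im,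
      Int.floor_add_intCast, Prod.ext_iff]
    simp
  rw [hpre]
  exact (measurePreserving_add_right volume (latticePt u)).setIntegral_preimage_emb
    (measurableEmbedding_addRight _) f _

/-- A function of bounded support whose periodization `F` satisfies `F q + F (-q) = 2 F 0` has
integral `F 0`: integrate the identity over a unit square. -/
theorem integral_eq_sum_of_second_difference {f : ℂ → ℝ} {R : ℝ} (hf : Integrable f)
    (hR : ∀ x, R < ‖x‖ → f x = 0) {T : Finset (ℤ × ℤ)}
    (hT : ∀ u : ℤ × ℤ, ‖latticePt u‖ ≤ R + 2 → u ∈ T)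
    (h0 : ∀ q, HasSum (fun u : ℤ × ℤ => f (latticePt u + q) + f (latticePt u - q) -
      2 * f (latticePt u)) 0) :
    ∫ x, f x = ∑ u ∈ T, f (latticePt u) := by
  have hfin : volume (unitSquare 0) ≠ ⊤ := by rw [volume_unitSquare]; simp
  have hz : ∀ u ∉ T, ∀ q ∈ unitSquare 0, f (latticePt u + q) = 0 ∧ f (latticePt u - q) = 0 ∧
      f (latticePt u) = 0 := by
    intro u hu q hq
    have h1 : R + 2 < ‖latticePt u‖ := not_le.mp fun h => hu (hT u h)
    have h2 := norm_lt_two_of_mem_unitSquare hq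
    refine ⟨hR _ ?_, hR _ ?_, hR _ (by linarith)⟩
    · have := norm_sub_le (latticePt u + q) q
      rw [add_sub_cancel_right] at this
      linarith
    · have := norm_add_le (latticePt u - q) q
      rw [sub_add_cancel] at this
      linarith
  have hplus : ∑ u ∈ T, ∫ x in unitSquare 0, f (latticePt u + x) = ∫ x, f x := by
    refine HasSum.unique (L := .unconditional _) (hasSum_sum_of_ne_finset_zero fun u hu => ?_) ?_
    · rw [setIntegral_congr_fun (measurableSet_unitSquare 0)
        (fun q hq => (hz u hu q hq).1), integral_zero]
    · simpa only [add_comm] using hasSum_setIntegral_unitSquare hf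
  have hminus : ∑ u ∈ T, ∫ x in unitSquare 0, f (latticePt u - x) = ∫ x, f x := by
    have h := hasSum_setIntegral_unitSquare hf.comp_neg
    rw [← (Equiv.neg (ℤ × ℤ)).hasSum_iff, integral_neg_eq_self] at h
    refine HasSum.unique (L := .unconditional _) (hasSum_sum_of_ne_finset_zero fun u hu => ?_) ?_
    · rw [setIntegral_congr_fun (measurableSet_unitSquare 0)
        (fun q hq => (hz u hu q hq).2.1), integral_zero]
    · convert h using 1
      funext u
      simp only [Function.comp_apply, Equiv.neg_apply, latticePt_neg]
      refine setIntegral_congr_fun (measurableSet_unitSquare 0) fun q _ => ?_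
      congr 1; ring
  have hiplus : ∀ u : ℤ × ℤ, IntegrableOn (fun x => f (latticePt u + x)) (unitSquare 0) :=
    fun u => (hf.comp_add_left (latticePt u)).integrableOn
  have himinus : ∀ u : ℤ × ℤ, IntegrableOn (fun x => f (latticePt u - x)) (unitSquare 0) :=
    fun u => (hf.comp_sub_left (latticePt u)).integrableOn
  have hic : ∀ c : ℝ, IntegrableOn (fun _ => c) (unitSquare 0) := fun c =>
    integrableOn_const hfin
  have hi2 : ∀ u : ℤ × ℤ, IntegrableOn (fun x => f (latticePt u + x) + f (latticePt u - x))
      (unitSquare 0) := fun u => (hiplus u).add (himinus u)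
  have hi3 : ∀ u : ℤ × ℤ, IntegrableOn (fun x => f (latticePt u + x) + f (latticePt u - x) -
      2 * f (latticePt u)) (unitSquare 0) := fun u => (hi2 u).sub (hic _)
  have hzero : ∑ u ∈ T, ∫ x in unitSquare 0, (f (latticePt u + x) + f (latticePt u - x) -
      2 * f (latticePt u)) = 0 := by
    rw [← integral_finsetSum T fun u _ => hi3 u]
    rw [setIntegral_congr_fun (g := fun _ => (0 : ℝ)) (measurableSet_unitSquare 0), integral_zero]
    intro q hq
    refine HasSum.unique (L := .unconditional _) (hasSum_sum_of_ne_finset_zero fun u hu => ?_)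
      (h0 q)
    obtain ⟨z1, z2, z3⟩ := hz u hu q hq
    rw [z1, z2, z3]; ring
  have hterm : ∀ u : ℤ × ℤ, ∫ x in unitSquare 0, (f (latticePt u + x) + f (latticePt u - x) -
      2 * f (latticePt u)) = (∫ x in unitSquare 0, f (latticePt u + x)) +
        (∫ x in unitSquare 0, f (latticePt u - x)) - 2 * f (latticePt u) := by
    intro u
    rw [integral_sub (hi2 u) (hic _), integral_add (hiplus u) (himinus u),
      setIntegral_const, measureReal_def, volume_unitSquare]
    simp
  simp only [hterm, Finset.sum_sub_distrib, Finset.sum_add_distrib, hplus, hminus,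
    ← Finset.mul_sum] at hzero
  linarith

namespace LatticeMultiPolygon

variable {d : ℕ} [NeZero d]

/-! ### The symmetric winding number -/

/-- The winding number of the loop `P` with the angle of a side seen from one of its own points
read as zero. It agrees with `P.winding` off the sides. -/
noncomputable def symWinding (P : LatticeMultiPolygon d) (x : ℂ) : ℝ :=
  (∑ i, symAngle x (P.pt i) (P.pt (i + 1))) / (2 * Real.pi)

/-- A bound for the norms of the vertices. -/
noncomputable def radius (P : LatticeMultiPolygon d) : ℝ := ∑ i, ‖P.pt i‖

theorem norm_pt_le_radius (P : LatticeMultiPolygon d) (i : Fin d) : ‖P.pt i‖ ≤ P.radius :=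
  Finset.single_le_sum (f := fun i => ‖P.pt i‖) (fun _ _ => norm_nonneg _) (Finset.mem_univ i)

theorem symWinding_eq_winding (P : LatticeMultiPolygon d) {x : ℂ} (hx : x ∈ P.supportᶜ) :
    P.symWinding x = P.winding x := by
  unfold symWinding winding
  congr 1
  refine Finset.sum_congr rfl fun i _ => symAngle_eq_sweptAngle fun h => hx ?_
  exact Set.mem_iUnion.mpr ⟨i, h⟩

theorem symWinding_eq_zero (P : LatticeMultiPolygon d) {x : ℂ} (hx : P.radius < ‖x‖) :
    P.symWinding x = 0 := by
  have h : ∀ i, symAngle x (P.pt i) (P.pt (i + 1)) =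
      (1 - P.pt (i + 1) / x).arg - (1 - P.pt i / x).arg := fun i =>
    symAngle_eq_of_norm_lt ((P.norm_pt_le_radius i).trans_lt hx)
      ((P.norm_pt_le_radius (i + 1)).trans_lt hx)
  rw [symWinding, Finset.sum_congr rfl fun i _ => h i, Finset.sum_sub_distrib,
    sum_fin_succ_eq fun i => (1 - P.pt i / x).arg, sub_self, zero_div]

theorem integrable_symWinding (P : LatticeMultiPolygon d) : Integrable P.symWinding := by
  have hm : Measurable P.symWinding :=
    (Finset.measurable_sum _ fun i _ => measurable_symAngle _ _).div_const _
  have hb : ∀ x, ‖P.symWinding x‖ ≤ (∑ _i : Fin d, Real.pi) / (2 * Real.pi) := fun x => by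
    rw [symWinding, norm_div, Real.norm_of_nonneg Real.two_pi_pos.le]
    gcongr
    exact (norm_sum_le _ _).trans (Finset.sum_le_sum fun i _ => abs_symAngle_le _ _ _)
  have hon : IntegrableOn P.symWinding (Metric.closedBall 0 P.radius) :=
    Measure.integrableOn_of_bounded measure_closedBall_lt_top.ne hm.aestronglyMeasurable
      (Eventually.of_forall hb)
  refine (integrableOn_iff_integrable_of_support_subset fun x hx => ?_).mp hon
  rw [mem_closedBall_zero_iff]
  by_contra h
  exact hx (P.symWinding_eq_zero (not_le.mp h))

theorem measurableSet_support (P : LatticeMultiPolygon d) : MeasurableSet P.support := by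
  refine MeasurableSet.iUnion fun i => ?_
  rw [← convexHull_pair]
  exact ((Set.toFinite _).isCompact_convexHull ℝ).measurableSet

theorem volume_support (P : LatticeMultiPolygon d) : volume P.support = 0 := by
  refine measure_iUnion_null fun i => ?_
  have hsub : segment ℝ (P.pt i) (P.pt (i + 1)) ⊆ (line[ℝ, P.pt i, P.pt (i + 1)] : Set ℂ) := by
    rw [← convexHull_pair]
    exact convexHull_subset_affineSpan _
  refine measure_mono_null hsub (Measure.addHaar_affineSubspace _ _ fun htop => ?_)
  have hc : Collinear ℝ {P.pt i, P.pt (i + 1)} := collinear_pair ℝ _ _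
  rw [collinear_iff_finrank_le_one, ← direction_affineSpan, htop, AffineSubspace.direction_top,
    finrank_top, Complex.finrank_real_complex] at hc
  omega

theorem integrableOn_winding (P : LatticeMultiPolygon d) :
    IntegrableOn P.winding P.supportᶜ :=
  P.integrable_symWinding.integrableOn.congr_fun (fun _ hx => P.symWinding_eq_winding hx)
    P.measurableSet_support.compl

theorem area_eq_integral (P : LatticeMultiPolygon d) : P.area = ∫ x, P.symWinding x := by
  rw [area, ← setIntegral_congr_fun P.measurableSet_support.compl
    fun _ hx => P.symWinding_eq_winding hx]
  refine setIntegral_eq_integral_of_ae_compl_eq_zero ?_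
  have h : ∀ᵐ x, x ∉ P.support := measure_eq_zero_iff_ae_notMem.mp P.volume_support
  filter_upwards [h] with x hx hx'
  exact absurd hx hx'

/-- The area is exactly the sum of the symmetric winding numbers of the lattice points. -/
theorem area_eq_sum (P : LatticeMultiPolygon d) {T : Finset (ℤ × ℤ)}
    (hT : ∀ u : ℤ × ℤ, ‖latticePt u‖ ≤ P.radius + 2 → u ∈ T) :
    P.area = ∑ u ∈ T, P.symWinding (latticePt u) := by
  rw [area_eq_integral]
  refine integral_eq_sum_of_second_difference P.integrable_symWinding
    (fun x hx => P.symWinding_eq_zero hx) hT fun q => ?_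
  have h := (hasSum_sum (s := Finset.univ) fun (i : Fin d) _ =>
    hasSum_second_difference_symAngle (P.vert i) (P.vert (i + 1)) q).div_const (2 * Real.pi)
  simp only [Finset.sum_const_zero, zero_div] at h
  refine h.congr_fun fun u => ?_
  simp only [symWinding, pt, Finset.sum_sub_distrib, Finset.sum_add_distrib, ← Finset.mul_sum]
  ring

/-! ### The normal vectors -/

theorem normal_ne_zero (P : LatticeMultiPolygon d) (i : Fin d) : P.normal i ≠ 0 := by
  unfold normal
  refine mul_ne_zero ?_ (mul_ne_zero (neg_ne_zero.mpr Complex.I_ne_zero)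
    (sub_ne_zero.mpr (P.pt_ne i).symm))
  exact_mod_cast (P.sgn i).ne_zero

/-- Consecutive normal vectors are never opposite. -/
theorem normal_div_mem_slitPlane (P : LatticeMultiPolygon d) (i : Fin d) :
    P.normal (i + 1) / P.normal i ∈ Complex.slitPlane := by
  have h1 := P.normal_ne_zero i
  have h2 := P.normal_ne_zero (i + 1)
  rw [Complex.mem_slitPlane_iff_not_le_zero]
  intro hle
  obtain ⟨hre, him⟩ := Complex.le_def.mp hle
  obtain ⟨r, hr, hq⟩ : ∃ r : ℝ, 0 ≤ r ∧ P.normal (i + 1) / P.normal i = ((-r : ℝ) : ℂ) :=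
    ⟨-(P.normal (i + 1) / P.normal i).re, by simpa using hre,
      Complex.ext (by simp) (by simpa using him)⟩
  rw [div_eq_iff h1] at hq
  simp only [normal] at hq
  have hne := P.pt_ne i
  have hr1 : (0 : ℝ) < 1 + r := by linarith
  have hr1c : (1 : ℂ) + r ≠ 0 := by exact_mod_cast hr1.ne'
  by_cases hs : P.sgn i = P.sgn (i + 1)
  · -- the loop turns back along the side without a change of sign
    have hee : ((P.sgn (i + 1) : ℤ) : ℂ) ≠ 0 := by exact_mod_cast (P.sgn (i + 1)).ne_zero
    rw [hs] at hq
    have hv : P.pt (i + 1 + 1) - P.pt (i + 1) = -r * (P.pt (i + 1) - P.pt i) := by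
      have := mul_ne_zero hee (neg_ne_zero.mpr Complex.I_ne_zero)
      apply mul_left_cancel₀ this
      push_cast at hq
      linear_combination hq
    refine P.sgn_ne i ?_ hs
    rcases le_total r 1 with h | h
    · right
      change P.pt (i + 1 + 1) ∈ segment ℝ (P.pt i) (P.pt (i + 1))
      rw [segment_eq_image']
      refine ⟨1 - r, ⟨by linarith, by linarith⟩, ?_⟩
      simp only [Complex.real_smul]
      push_cast
      linear_combination -hv
    · left
      change P.pt i ∈ segment ℝ (P.pt (i + 1)) (P.pt (i + 1 + 1))
      rw [segment_eq_image']
      refine ⟨1 / r, ⟨by positivity, by rw [div_le_one (by linarith)]; exact h⟩, ?_⟩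
      have hr0 : (r : ℂ) ≠ 0 := by
        have : r ≠ 0 := by linarith
        exact_mod_cast this
      simp only [Complex.real_smul, hv]
      push_cast
      field_simp
      ring
  · -- the loop goes straight on with a change of sign
    have hs' : P.sgn (i + 1) = -P.sgn i := by
      rcases Int.units_eq_one_or (P.sgn i) with h | h <;>
        rcases Int.units_eq_one_or (P.sgn (i + 1)) with h' | h' <;> simp_all
    have hee : ((P.sgn i : ℤ) : ℂ) ≠ 0 := by exact_mod_cast (P.sgn i).ne_zero
    rw [hs'] at hq
    have hv : P.pt (i + 1 + 1) - P.pt (i + 1) = r * (P.pt (i + 1) - P.pt i) := by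
      have := mul_ne_zero hee (neg_ne_zero.mpr Complex.I_ne_zero)
      apply mul_left_cancel₀ this
      push_cast at hq
      linear_combination -hq
    refine hs (P.sgn_eq i ?_)
    change P.pt (i + 1) ∈ segment ℝ (P.pt i) (P.pt (i + 1 + 1))
    rw [segment_eq_image']
    refine ⟨1 / (1 + r), ⟨by positivity, by rw [div_le_one hr1]; linarith⟩, ?_⟩
    simp only [Complex.real_smul]
    push_cast
    field_simp
    linear_combination hv

/-! ### Lattice points on the sides -/

/-- On the line through `p` in a primitive direction `w`, the lattice points are the integer
steps from `p`. -/
theorem ncard_mem_segment {p w : ℤ × ℤ} (hw : IsCoprime w.1 w.2) (g : ℕ) :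
    {u : ℤ × ℤ | latticePt u ∈ segment ℝ (latticePt p) (latticePt (p + g • w))}.ncard = g + 1 := by
  have hsm : ∀ k : ℕ, latticePt (k • w) = k * latticePt w := fun k => by
    apply Complex.ext <;> simp [latticePt]
  have hinj : Function.Injective fun k : ℕ => p + k • w := by
    intro k l h
    simp only [add_right_inj, Prod.ext_iff, Prod.smul_fst, Prod.smul_snd] at h
    simp only [nsmul_eq_mul] at h
    obtain ⟨a, b, hab⟩ := hw
    have : (k : ℤ) = l := by linear_combination (l - k : ℤ) * hab + a * h.1 + b * h.2
    exact_mod_cast this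
  have hset : {u : ℤ × ℤ | latticePt u ∈ segment ℝ (latticePt p) (latticePt (p + g • w))} =
      (fun k : ℕ => p + k • w) '' (Finset.range (g + 1) : Set ℕ) := by
    ext u
    simp only [Set.mem_ofPred_eq, Set.mem_image, Finset.coe_range, Set.mem_Iio,
      segment_eq_image', latticePt_add, hsm, Complex.real_smul, add_sub_cancel_left]
    constructor
    · rintro ⟨s, ⟨hs0, hs1⟩, h⟩
      have h1 := congrArg Complex.re h
      have h2 := congrArg Complex.im h
      simp [latticePt] at h1 h2
      obtain ⟨a, b, hab⟩ := hw
      have hab' : (a : ℝ) * w.1 + b * w.2 = 1 := by exact_mod_cast hab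
      have hk : s * g = ((a * (u.1 - p.1) + b * (u.2 - p.2) : ℤ) : ℝ) := by
        push_cast
        linear_combination a * h1 + b * h2 - s * g * hab'
      set k := a * (u.1 - p.1) + b * (u.2 - p.2) with hkdef
      have hk0 : 0 ≤ k := by
        have : (0 : ℝ) ≤ (k : ℝ) := by rw [← hk]; positivity
        exact_mod_cast this
      have hkg : k ≤ g := by
        have : (k : ℝ) ≤ g := by rw [← hk]; nlinarith [Nat.cast_nonneg (α := ℝ) g]
        exact_mod_cast this
      refine ⟨k.toNat, by omega, ?_⟩
      have hkn : (k.toNat : ℤ) = k := Int.toNat_of_nonneg hk0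
      have e1 : p.1 + k * w.1 = u.1 := by
        have : (p.1 : ℝ) + k * w.1 = u.1 := by rw [← hk]; linarith
        exact_mod_cast this
      have e2 : p.2 + k * w.2 = u.2 := by
        have : (p.2 : ℝ) + k * w.2 = u.2 := by rw [← hk]; linarith
        exact_mod_cast this
      apply Prod.ext
      · simpa [hk0] using e1
      · simpa [hk0] using e2
    · rintro ⟨k, hk, rfl⟩
      rcases Nat.eq_zero_or_pos g with rfl | hg
      · refine ⟨0, by simp, ?_⟩
        have : k = 0 := by omega
        simp [this]
      · have hg' : (0 : ℝ) < g := by exact_mod_cast hg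
        have hgc : (g : ℂ) ≠ 0 := by exact_mod_cast hg.ne'
        refine ⟨k / g, ⟨by positivity, ?_⟩, ?_⟩
        · rw [div_le_one hg']; exact_mod_cast Nat.lt_succ_iff.mp hk
        · rw [latticePt_add, hsm]
          push_cast
          field_simp
  rw [hset, Set.ncard_image_of_injective _ hinj, Set.ncard_coe_finset, Finset.card_range]

theorem sideLength_eq_gcd (P : LatticeMultiPolygon d) (i : Fin d) :
    P.sideLength i = Int.gcd ((P.vert (i + 1)).1 - (P.vert i).1)
      ((P.vert (i + 1)).2 - (P.vert i).2) := by
  set x := (P.vert (i + 1)).1 - (P.vert i).1 with hx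
  set y := (P.vert (i + 1)).2 - (P.vert i).2 with hy
  have hg : 0 < Int.gcd x y := by
    rw [Int.gcd_pos_iff]
    by_contra! h
    apply P.pt_ne i
    unfold pt
    congr 1
    exact Prod.ext (by linarith [h.1]) (by linarith [h.2])
  obtain ⟨a, b, hab, ha, hb⟩ := Int.exists_gcd_one hg
  have hv : P.vert (i + 1) = P.vert i + Int.gcd x y • ((a, b) : ℤ × ℤ) := by
    apply Prod.ext
    · simp only [Prod.fst_add, Prod.smul_fst]; rw [nsmul_eq_mul]; linarith
    · simp only [Prod.snd_add, Prod.smul_snd]; rw [nsmul_eq_mul]; linarith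
  have h := ncard_mem_segment (p := P.vert i) (w := (a, b))
    (Int.isCoprime_iff_gcd_eq_one.mpr hab) (Int.gcd x y)
  rw [← hv] at h
  rw [sideLength]
  unfold pt
  rw [h]
  push_cast
  ring

/-- The angles gained at the lattice points of a side add up to `π` times its lattice length. -/
theorem sum_angleJump (P : LatticeMultiPolygon d) (i : Fin d) {T : Finset (ℤ × ℤ)}
    (hT : ∀ u : ℤ × ℤ, ‖latticePt u‖ ≤ P.radius + 2 → u ∈ T) :
    ∑ u ∈ T, angleJump (latticePt u) (P.pt i) (P.pt (i + 1)) = Real.pi * P.sideLength i := by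
  classical
  have hmem : ∀ j, P.vert j ∈ T := fun j =>
    hT _ ((P.norm_pt_le_radius j).trans (by linarith))
  have hseg : {u : ℤ × ℤ | latticePt u ∈ segment ℝ (P.pt i) (P.pt (i + 1))} =
      ((T.filter fun u => latticePt u ∈ segment ℝ (P.pt i) (P.pt (i + 1)) : Finset (ℤ × ℤ)) :
        Set (ℤ × ℤ)) := by
    ext u
    simp only [Set.mem_ofPred_eq, Finset.coe_filter, iff_and_self]
    intro hu
    have := (convex_closedBall (0 : ℂ) P.radius).segment_subset
      (mem_closedBall_zero_iff.mpr (P.norm_pt_le_radius i))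
      (mem_closedBall_zero_iff.mpr (P.norm_pt_le_radius (i + 1))) hu
    rw [mem_closedBall_zero_iff] at this
    exact hT u (by linarith)
  have hpt : ∀ j, ∑ u ∈ T, (if latticePt u = P.pt j then Real.pi / 2 else 0) = Real.pi / 2 := by
    intro j
    rw [Finset.sum_eq_single (P.vert j)]
    · exact if_pos rfl
    · exact fun u _ hu => if_neg fun h => hu (latticePt_injective h)
    · exact fun h => absurd (hmem j) h
  simp only [angleJump, Finset.sum_sub_distrib]
  rw [sideLength, hseg, Set.ncard_coe_finset]
  have h1 := hpt i
  have h2 := hpt (i + 1)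
  have h3 : ∑ u ∈ T, (if latticePt u ∈ segment ℝ (P.pt i) (P.pt (i + 1)) then Real.pi else 0) =
      Real.pi * (T.filter fun u => latticePt u ∈ segment ℝ (P.pt i) (P.pt (i + 1))).card := by
    rw [← Finset.sum_filter, Finset.sum_const, nsmul_eq_mul, mul_comm]
  push_cast
  calc _ = Real.pi * (T.filter fun u => latticePt u ∈ segment ℝ (P.pt i) (P.pt (i + 1))).card -
        Real.pi / 2 - Real.pi / 2 := by
        refine congrArg₂ (· - ·) (congrArg₂ (· - ·) (Eq.trans ?_ h3) (Eq.trans ?_ h1))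
          (Eq.trans ?_ h2) <;> exact Finset.sum_congr rfl fun u _ => by congr
    _ = _ := by ring

/-! ### The pushed loop -/

theorem pushStart_mem_pushSupport (P : LatticeMultiPolygon d) (t : Fin d → ℝ) (i : Fin d) :
    P.pushStart t i ∈ P.pushSupport t :=
  Set.mem_iUnion.mpr ⟨i, Or.inl (left_mem_segment ℝ _ _)⟩

theorem pushEnd_mem_pushSupport (P : LatticeMultiPolygon d) (t : Fin d → ℝ) (i : Fin d) :
    P.pushEnd t i ∈ P.pushSupport t :=
  Set.mem_iUnion.mpr ⟨i, Or.inl (right_mem_segment ℝ _ _)⟩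

theorem pushWinding_mem_range_intCast (P : LatticeMultiPolygon d) {t : Fin d → ℝ} {x : ℂ}
    (hx : x ∉ P.pushSupport t) : P.pushWinding t x ∈ Set.range ((↑) : ℤ → ℝ) := by
  have hs : ∀ i, P.pushStart t i - x ≠ 0 := fun i h =>
    hx (sub_eq_zero.mp h ▸ P.pushStart_mem_pushSupport t i)
  have he : ∀ i, P.pushEnd t i - x ≠ 0 := fun i h =>
    hx (sub_eq_zero.mp h ▸ P.pushEnd_mem_pushSupport t i)
  -- modulo `2π` the swept angles are differences of arguments, and their sum telescopes
  have h0 : ((∑ i, (sweptAngle x (P.pushStart t i) (P.pushEnd t i) +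
      sweptAngle x (P.pushEnd t i) (P.pushStart t (i + 1))) : ℝ) : Real.Angle) = 0 := by
    rw [← Real.Angle.coe_coeHom, map_sum]
    have hterm : ∀ i, Real.Angle.coeHom (sweptAngle x (P.pushStart t i) (P.pushEnd t i) +
        sweptAngle x (P.pushEnd t i) (P.pushStart t (i + 1))) =
        ((P.pushStart t (i + 1) - x).arg : Real.Angle) -
          ((P.pushStart t i - x).arg : Real.Angle) := by
      intro i
      rw [map_add, Real.Angle.coe_coeHom, sweptAngle, sweptAngle,
        Complex.arg_div_coe_angle (he i) (hs i), Complex.arg_div_coe_angle (hs (i + 1)) (he i)]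
      abel
    rw [Finset.sum_congr rfl fun i _ => hterm i, Finset.sum_sub_distrib,
      sum_fin_succ_eq fun i => ((P.pushStart t i - x).arg : Real.Angle), sub_self]
  obtain ⟨n, hn⟩ := Real.Angle.coe_eq_zero_iff.mp h0
  refine ⟨n, ?_⟩
  rw [pushWinding, ← hn, zsmul_eq_mul, mul_div_cancel_right₀ _ Real.two_pi_pos.ne']

theorem pushWinding_eq_zero (P : LatticeMultiPolygon d) {t : Fin d → ℝ} {x : ℂ}
    (hs : ∀ i, ‖P.pushStart t i‖ < ‖x‖) (he : ∀ i, ‖P.pushEnd t i‖ < ‖x‖) :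
    P.pushWinding t x = 0 := by
  have h : ∀ i, sweptAngle x (P.pushStart t i) (P.pushEnd t i) +
      sweptAngle x (P.pushEnd t i) (P.pushStart t (i + 1)) =
      (1 - P.pushStart t (i + 1) / x).arg - (1 - P.pushStart t i / x).arg := fun i => by
    rw [sweptAngle_eq_of_norm_lt (hs i) (he i), sweptAngle_eq_of_norm_lt (he i) (hs (i + 1))]
    ring
  rw [pushWinding, Finset.sum_congr rfl fun i _ => h i, Finset.sum_sub_distrib,
    sum_fin_succ_eq fun i => (1 - P.pushStart t i / x).arg, sub_self, zero_div]

theorem notMem_pushSupport_of_norm_lt (P : LatticeMultiPolygon d) {t : Fin d → ℝ} {x : ℂ}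
    (hs : ∀ i, ‖P.pushStart t i‖ < ‖x‖) (he : ∀ i, ‖P.pushEnd t i‖ < ‖x‖) :
    x ∉ P.pushSupport t := by
  have key : ∀ a b : ℂ, ‖a‖ < ‖x‖ → ‖b‖ < ‖x‖ → x ∉ segment ℝ a b := fun a b ha hb h => by
    have := (convex_ball (0 : ℂ) ‖x‖).segment_subset (mem_ball_zero_iff.mpr ha)
      (mem_ball_zero_iff.mpr hb) h
    simp at this
  intro h
  obtain ⟨i, h | h⟩ := Set.mem_iUnion.mp h
  · exact key _ _ (hs i) (he i) h
  · exact key _ _ (he i) (hs (i + 1)) h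

theorem tendsto_add_push (P : LatticeMultiPolygon d) (c : ℂ) (i : Fin d) :
    Tendsto (fun t : Fin d → ℝ => c + t i * P.normal i)
      (𝓝[{t : Fin d → ℝ | ∀ i, 0 < t i}] 0) (𝓝 c) := by
  simpa using ((tendsto_ofReal_nhdsGT.comp (tendsto_apply_push i)).mul_const
    (P.normal i)).const_add c

/-- The segment that joins two consecutive pushed sides: seen from their common vertex it always
sweeps the angle between the two normal vectors, from elsewhere it sweeps no angle in the limit. -/
theorem tendsto_sweptAngle_joint (P : LatticeMultiPolygon d) (i : Fin d) (u : ℂ) :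
    (∀ᶠ t in 𝓝[{t : Fin d → ℝ | ∀ i, 0 < t i}] 0,
        u ∉ segment ℝ (P.pushEnd t i) (P.pushStart t (i + 1))) ∧
      Tendsto (fun t => sweptAngle u (P.pushEnd t i) (P.pushStart t (i + 1)))
        (𝓝[{t : Fin d → ℝ | ∀ i, 0 < t i}] 0)
        (𝓝 (open Classical in
          if u = P.pt (i + 1) then sweptAngle 0 (P.normal i) (P.normal (i + 1)) else 0)) := by
  by_cases hu : u = P.pt (i + 1)
  · rw [if_pos hu]
    have hq : ∀ᶠ t in 𝓝[{t : Fin d → ℝ | ∀ i, 0 < t i}] 0, ∃ c : ℝ, 0 < c ∧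
        (P.pushStart t (i + 1) - u) / (P.pushEnd t i - u) =
          c * (P.normal (i + 1) / P.normal i) := by
      filter_upwards [self_mem_nhdsWithin] with t ht
      refine ⟨t (i + 1) / t i, div_pos (ht _) (ht _), ?_⟩
      rw [hu, pushStart, pushEnd, add_sub_cancel_left, add_sub_cancel_left, mul_div_mul_comm]
      push_cast
      rfl
    constructor
    · filter_upwards [hq] with t ⟨c, hc, h⟩
      apply notMem_segment_of_mem_slitPlane
      have hs := P.normal_div_mem_slitPlane i
      rw [Complex.mem_slitPlane_iff_arg] at hs ⊢
      rw [h, Complex.arg_real_mul _ hc]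
      exact ⟨hs.1, mul_ne_zero (by exact_mod_cast hc.ne') hs.2⟩
    · refine tendsto_const_nhds.congr' ?_
      filter_upwards [hq] with t ⟨c, hc, h⟩
      rw [sweptAngle, sweptAngle, h, Complex.arg_real_mul _ hc, sub_zero, sub_zero]
  · rw [if_neg hu]
    have h := tendsto_quotient_slitPlane (u := u) (a := P.pt (i + 1)) (b := P.pt (i + 1))
      (by rwa [segment_same, Set.mem_singleton_iff]) (P.tendsto_add_push _ i)
      (P.tendsto_add_push _ (i + 1))
    rw [show sweptAngle u (P.pt (i + 1)) (P.pt (i + 1)) = 0 by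
      rw [sweptAngle, div_self (sub_ne_zero.mpr (Ne.symm hu)), Complex.arg_one]] at h
    exact h

/-- The pushed winding number around a point, in the limit: the symmetric winding number, half of
the sign of every side through the point (a quarter at an end of the side), and the turn of the
normal vectors at every vertex in the point. -/
theorem tendsto_pushWinding (P : LatticeMultiPolygon d) (u : ℂ) :
    (∀ᶠ t in 𝓝[{t : Fin d → ℝ | ∀ i, 0 < t i}] 0, u ∉ P.pushSupport t) ∧
      Tendsto (fun t => P.pushWinding t u) (𝓝[{t : Fin d → ℝ | ∀ i, 0 < t i}] 0)
        (𝓝 (P.symWinding u + (∑ i, ((P.sgn i : ℤ) * angleJump u (P.pt i) (P.pt (i + 1)) +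
          open Classical in
          if u = P.pt (i + 1) then sweptAngle 0 (P.normal i) (P.normal (i + 1)) else 0)) /
            (2 * Real.pi))) := by
  have hside := fun i => tendsto_sweptAngle_push (P.sgn i) (P.pt_ne i) u
  have hjoint := fun i => P.tendsto_sweptAngle_joint i u
  constructor
  · have h : ∀ i, ∀ᶠ t in 𝓝[{t : Fin d → ℝ | ∀ i, 0 < t i}] 0,
        u ∉ segment ℝ (P.pushStart t i) (P.pushEnd t i) ∪
          segment ℝ (P.pushEnd t i) (P.pushStart t (i + 1)) := fun i => by
      filter_upwards [(tendsto_apply_push i).eventually (hside i).1, (hjoint i).1] with t h1 h2 h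
      exact h.elim h1 h2
    filter_upwards [eventually_all.mpr h] with t ht hmem
    obtain ⟨i, hi⟩ := Set.mem_iUnion.mp hmem
    exact ht i hi
  · have h := (tendsto_finsetSum Finset.univ fun i _ =>
      ((hside i).2.comp (tendsto_apply_push i)).add (hjoint i).2).div_const (2 * Real.pi)
    simp only [add_assoc] at h
    rw [Finset.sum_add_distrib, add_div] at h
    exact h

/-- The generalized Pick formula. -/
theorem hasSharp (P : LatticeMultiPolygon d) :
    P.HasSharp (P.area + (P.boundary : ℝ) / 2 + P.rotation) := by
  classical
  set l := 𝓝[{t : Fin d → ℝ | ∀ i, 0 < t i}] 0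
  set T := (finite_norm_latticePt_le (P.radius + 2)).toFinset with hTdef
  have hT : ∀ u : ℤ × ℤ, ‖latticePt u‖ ≤ P.radius + 2 → u ∈ T := fun u hu => by
    rw [hTdef, Set.Finite.mem_toFinset]; exact hu
  have hnear : ∀ᶠ t in l, ∀ u ∈ T, latticePt u ∉ P.pushSupport t :=
    (Filter.eventually_all_finset T).mpr fun u _ => (P.tendsto_pushWinding (latticePt u)).1
  have hbound : ∀ i, ∀ᶠ t in l, ‖P.pushStart t i‖ < P.radius + 2 ∧
      ‖P.pushEnd t i‖ < P.radius + 2 := fun i => by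
    have h1 : ‖P.pt i‖ < P.radius + 2 := (P.norm_pt_le_radius i).trans_lt (by linarith)
    have h2 : ‖P.pt (i + 1)‖ < P.radius + 2 :=
      (P.norm_pt_le_radius (i + 1)).trans_lt (by linarith)
    exact ((P.tendsto_add_push (P.pt i) i).norm.eventually_lt_const h1).and
      ((P.tendsto_add_push (P.pt (i + 1)) i).norm.eventually_lt_const h2)
  have hfar : ∀ᶠ t in l, ∀ u ∉ T, latticePt u ∉ P.pushSupport t ∧
      P.pushWinding t (latticePt u) = 0 := by
    filter_upwards [eventually_all.mpr hbound] with t ht u hu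
    have hu' : P.radius + 2 < ‖latticePt u‖ := not_le.mp fun h => hu (hT u h)
    have hs := fun i => (ht i).1.trans hu'
    have he := fun i => (ht i).2.trans hu'
    exact ⟨P.notMem_pushSupport_of_norm_lt hs he, P.pushWinding_eq_zero hs he⟩
  -- the limit of the sum of the pushed winding numbers
  have hlim := tendsto_finsetSum T fun u _ => (P.tendsto_pushWinding (latticePt u)).2
  have hval : ∑ u ∈ T, (P.symWinding (latticePt u) +
      (∑ i, ((P.sgn i : ℤ) * angleJump (latticePt u) (P.pt i) (P.pt (i + 1)) +
        if latticePt u = P.pt (i + 1) then sweptAngle 0 (P.normal i) (P.normal (i + 1)) else 0)) /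
            (2 * Real.pi)) = P.area + (P.boundary : ℝ) / 2 + P.rotation := by
    have hjoint : ∀ i, ∑ u ∈ T, (if latticePt u = P.pt (i + 1) then
        sweptAngle 0 (P.normal i) (P.normal (i + 1)) else 0) =
          sweptAngle 0 (P.normal i) (P.normal (i + 1)) := by
      intro i
      rw [Finset.sum_eq_single (P.vert (i + 1))]
      · exact if_pos rfl
      · exact fun u _ hu => if_neg fun h => hu (latticePt_injective h)
      · exact fun h => absurd (hT _ ((P.norm_pt_le_radius (i + 1)).trans (by linarith))) h
    rw [Finset.sum_add_distrib, ← P.area_eq_sum hT, ← Finset.sum_div, Finset.sum_comm]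
    have hi : ∀ i, ∑ u ∈ T, ((P.sgn i : ℤ) * angleJump (latticePt u) (P.pt i) (P.pt (i + 1)) +
        if latticePt u = P.pt (i + 1) then sweptAngle 0 (P.normal i) (P.normal (i + 1)) else 0) =
        Real.pi * (((P.sgn i : ℤ) * P.sideLength i : ℤ) : ℝ) +
          sweptAngle 0 (P.normal i) (P.normal (i + 1)) := by
      intro i
      rw [Finset.sum_add_distrib, hjoint, ← Finset.mul_sum, P.sum_angleJump i hT]
      push_cast
      ring
    rw [Finset.sum_congr rfl fun i _ => hi i, Finset.sum_add_distrib, ← Finset.mul_sum, add_div,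
      ← Int.cast_sum, rotation, boundary, add_assoc]
    congr 2
    field_simp
  have hlim' : Tendsto (fun t => ∑ u ∈ T, P.pushWinding t (latticePt u)) l
      (𝓝 (P.area + (P.boundary : ℝ) / 2 + P.rotation)) := by
    rw [← hval]
    convert hlim using 6
  -- the sums are integers, so they are eventually equal to their limit
  have hint : ∀ᶠ t in l, ∑ u ∈ T, P.pushWinding t (latticePt u) ∈
      Set.range ((↑) : ℤ → ℝ) := by
    filter_upwards [hnear] with t ht
    exact (Int.castAddHom ℝ).range.sum_mem fun u hu => P.pushWinding_mem_range_intCast (ht u hu)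
  have heq : ∀ᶠ t in l, ∑ u ∈ T, P.pushWinding t (latticePt u) =
      P.area + (P.boundary : ℝ) / 2 + P.rotation := by
    have : l.NeBot := by
      have h : Tendsto (fun s : ℝ => fun _ : Fin d => s) (𝓝[>] 0) l := by
        refine tendsto_nhdsWithin_iff.mpr ⟨?_, ?_⟩
        · exact tendsto_pi_nhds.mpr fun _ => tendsto_id.mono_left nhdsWithin_le_nhds
        · filter_upwards [self_mem_nhdsWithin] with s hs using fun _ => hs
      exact h.neBot
    obtain ⟨n, hn⟩ := Int.isClosedEmbedding_coe_real.isClosed_range.mem_of_tendsto hlim' hint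
    filter_upwards [hint, hlim'.eventually (Metric.ball_mem_nhds _ one_pos)] with t ⟨k, hk⟩ ht
    rw [← hk, ← hn, Int.dist_cast_real, Int.dist_eq] at ht
    have h1 : |k - n| < 1 := by exact_mod_cast ht
    rw [Int.abs_lt_one_iff, sub_eq_zero] at h1
    rw [← hk, ← hn, h1]
  filter_upwards [hnear, hfar, heq] with t h1 h2 h3
  have hsub : (Function.support fun u : ℤ × ℤ => P.pushWinding t (latticePt u)) ⊆ T := by
    intro u hu
    by_contra h
    exact hu (h2 u h).2
  refine ⟨fun u => ?_, T.finite_toSet.subset hsub, ?_⟩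
  · by_cases hu : u ∈ T
    · exact h1 u hu
    · exact (h2 u hu).1
  · rw [finsum_eq_sum_of_support_subset _ hsub, h3]

/-! ### Reversal of the signs and dilation -/

theorem area_opposite (P : LatticeMultiPolygon d) : P.opposite.area = P.area := rfl

theorem boundary_opposite (P : LatticeMultiPolygon d) : P.opposite.boundary = -P.boundary := by
  rw [boundary, boundary, ← Finset.sum_neg_distrib]
  refine Finset.sum_congr rfl fun i _ => ?_
  change ((-P.sgn i : ℤˣ) : ℤ) * P.sideLength i = _
  push_cast
  ring

theorem rotation_opposite (P : LatticeMultiPolygon d) : P.opposite.rotation = P.rotation := by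
  have hn : ∀ i, P.opposite.normal i = -P.normal i := fun i => by
    change (((-P.sgn i : ℤˣ) : ℤ) : ℂ) * (-Complex.I * (P.pt (i + 1) - P.pt i)) = _
    rw [normal]
    push_cast
    ring
  simp only [rotation, hn, sweptAngle, sub_zero, neg_div_neg_eq]

theorem pt_dilate (P : LatticeMultiPolygon d) {m : ℕ} (hm : 0 < m) (i : Fin d) :
    (P.dilate m hm).pt i = ((m : ℝ) : ℂ) * P.pt i := by
  apply Complex.ext <;> simp [pt, dilate, latticePt]

theorem area_dilate (P : LatticeMultiPolygon d) {m : ℕ} (hm : 0 < m) :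
    (P.dilate m hm).area = P.area * m ^ 2 := by
  have hm' : (0 : ℝ) < m := by exact_mod_cast hm
  have hmc : ((m : ℝ) : ℂ) ≠ 0 := by exact_mod_cast hm'.ne'
  have hw : ∀ x, (P.dilate m hm).symWinding ((m : ℝ) • x) = P.symWinding x := by
    intro x
    simp only [symWinding, symAngle, sweptAngle, pt_dilate, Complex.real_smul, ← mul_sub,
      mul_div_mul_left _ _ hmc]
  have h := Measure.integral_comp_smul volume (P.dilate m hm).symWinding (m : ℝ)
  simp only [hw] at h
  rw [area_eq_integral, area_eq_integral, h, Complex.finrank_real_complex,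
    abs_of_pos (by positivity), smul_eq_mul]
  field_simp

theorem boundary_dilate (P : LatticeMultiPolygon d) {m : ℕ} (hm : 0 < m) :
    (P.dilate m hm).boundary = P.boundary * m := by
  rw [boundary, boundary, Finset.sum_mul]
  refine Finset.sum_congr rfl fun i _ => ?_
  have hs : (P.dilate m hm).sgn i = P.sgn i := rfl
  rw [sideLength_eq_gcd, sideLength_eq_gcd, hs]
  simp only [dilate, Prod.smul_fst, Prod.smul_snd]
  simp only [nsmul_eq_mul, ← mul_sub]
  rw [Int.gcd_mul_left]
  push_cast [Int.natAbs_natCast]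
  ring

theorem rotation_dilate (P : LatticeMultiPolygon d) {m : ℕ} (hm : 0 < m) :
    (P.dilate m hm).rotation = P.rotation := by
  have hm' : (0 : ℝ) < m := by exact_mod_cast hm
  have hn : ∀ i, (P.dilate m hm).normal i = ((m : ℝ) : ℂ) * P.normal i := fun i => by
    rw [normal, normal, pt_dilate, pt_dilate]
    change ((P.sgn i : ℤ) : ℂ) * _ = _
    ring
  simp only [rotation, hn, sweptAngle_real_mul hm']

end LatticeMultiPolygon

theorem theorem3p1 {d : ℕ} [NeZero d] (P : LatticeMultiPolygon d) :
    IntegrableOn P.winding P.supportᶜ ∧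
    P.HasSharp (P.area + (P.boundary : ℝ) / 2 + P.rotation) ∧
    P.opposite.HasSharp (P.area - (P.boundary : ℝ) / 2 + P.rotation) ∧
    ∃ E : Polynomial ℝ,
      E.natDegree ≤ 2 ∧
      E.coeff 2 = P.area ∧ E.coeff 1 = (P.boundary : ℝ) / 2 ∧ E.coeff 0 = P.rotation ∧
      ∀ (m : ℕ) (hm : 0 < m),
        (P.dilate m hm).HasSharp (E.eval (m : ℝ)) ∧
        (P.opposite.dilate m hm).HasSharp (E.eval (-(m : ℝ))) := by
  refine ⟨P.integrableOn_winding, P.hasSharp, ?_,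
    Polynomial.C P.area * Polynomial.X ^ 2 + Polynomial.C ((P.boundary : ℝ) / 2) * Polynomial.X +
      Polynomial.C P.rotation, Polynomial.natDegree_quadratic_le, ?_, ?_, ?_, fun m hm => ⟨?_, ?_⟩⟩
  · convert P.opposite.hasSharp using 1
    rw [P.area_opposite, P.boundary_opposite, P.rotation_opposite]
    push_cast
    ring
  · simp
  · simp [Polynomial.coeff_C]
  · simp
  · convert (P.dilate m hm).hasSharp using 1
    rw [P.area_dilate, P.boundary_dilate, P.rotation_dilate]
    simp
    ring
  · convert (P.opposite.dilate m hm).hasSharp using 1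
    rw [P.opposite.area_dilate, P.opposite.boundary_dilate, P.opposite.rotation_dilate,
      P.area_opposite, P.boundary_opposite, P.rotation_opposite]
    simp
    ring
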